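/- Let $H$ be a complex Hilbert space and let $C$ be a closed densely defined linear operator in $H$. Products and powers of operators have their natural domains, $C^{*n}$ means $(C^*)^n$, and $A^0=I$. Write $\mathbb R_+=[0,\infty)$ and $\mathbb Z_+=\{0,1,2,\dots\}$. A spectral Borel measure on $\mathbb R_+$ is a map $E$ from the Borel subsets of $\mathbb R_+$ to the orthogonal projections of $H$ that is countably additive in the strong operator topology and satisfies $E(\mathbb R_+)=I$; for a real Borel function $f$, $\int_{\mathbb R_+} f\,dE$ is the operator with domain $\{x : \int |f|^2\,d\langle E(\cdot)x,x\rangle<\infty\}$ determined by $\langle (\int f\,dE)x,x\rangle=\int f\,d\langle E(\cdot)x,x\rangle$ for all $x$ in that domain. The operator $C$ is called quasinormal if $E_{|C|}(\Delta)\,C\subseteq C\,E_{|C|}(\Delta)$ for every Borel set $\Delta\subseteq\mathbb R_+$, where $|C|$ is the positive selfadjoint square root of $C^*C$ and $E_{|C|}$ is its spectral measure, so that $|C|=\int_{\mathbb R_+}x\,E_{|C|}(dx)$. Then the following conditions are equivalent: (i) $C$ is quasinormal; (ii) $C^{*n}C^n=(C^*C)^n$ for every $n\in\mathbb Z_+$;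 (iii) there exists a spectral Borel measure $E$ on $\mathbb R_+$ such that $C^{*n}C^n=\int_{\mathbb R_+}x^n\,E(dx)$ for every $n\in\mathbb Z_+$; (iv) there exists a spectral Borel measure $E$ on $\mathbb R_+$ such that $C^{*n}C^n=\int_{\mathbb R_+}x^n\,E(dx)$ for $n\in\{1,2,3\}$; (v) $C^{*n}C^n=(C^*C)^n$ for $n\in\{2,3\}$. Moreover, a spectral measure $E$ as in (iii) is unique, and so is a spectral measure $E$ as in (iv). -/

import Mathlib

open MeasureTheory
open scoped NNReal ENNReal InnerProductSpace LinearPMap Function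

namespace UnboundedOp

noncomputable section

/-- The product `A B` of (unbounded) operators with its natural domain
`D(A B) = {x ∈ D(B) : B x ∈ D(A)}`. -/
def mul {H : Type*} [AddCommGroup H] [Module ℂ H] (A B : H →ₗ.[ℂ] H) : H →ₗ.[ℂ] H where
  domain := (A.domain.comap B.toFun).map B.domain.subtype
  toFun := A.toFun.comp
    ((B.toFun.comp
      (Submodule.inclusion (Submodule.map_subtype_le _ _))).codRestrict A.domain (by
        rintro ⟨x, hx⟩
        obtain ⟨y, hy, rfl⟩ := hx
        exact hy))

theorem mem_mul_domain {H : Type*} [AddCommGroup H] [Module ℂ H] {A B : H →ₗ.[ℂ] H} {x : H} :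
    x ∈ (mul A B).domain ↔ ∃ h : x ∈ B.domain, B ⟨x, h⟩ ∈ A.domain := by
  constructor
  · rintro ⟨y, hy, rfl⟩
    exact ⟨y.2, hy⟩
  · rintro ⟨h, h'⟩
    exact ⟨⟨x, h⟩, h', rfl⟩

theorem mul_apply {H : Type*} [AddCommGroup H] [Module ℂ H] {A B : H →ₗ.[ℂ] H}
    (x : (mul A B).domain) (h : (x : H) ∈ B.domain) (h' : B ⟨x, h⟩ ∈ A.domain) :
    mul A B x = A ⟨B ⟨x, h⟩, h'⟩ := rfl

/-- A bounded, everywhere defined operator, regarded as a partially defined operator with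
domain the whole space. -/
def ofBounded {H : Type*} [NormedAddCommGroup H] [InnerProductSpace ℂ H] (T : H →L[ℂ] H) :
    H →ₗ.[ℂ] H :=
  (T : H →ₗ[ℂ] H).toPMap ⊤

/-- The powers of an operator with their natural domains: `A⁰ = I` (defined everywhere) and
`Aⁿ⁺¹ = Aⁿ A`. -/
def pow {H : Type*} [NormedAddCommGroup H] [InnerProductSpace ℂ H] (A : H →ₗ.[ℂ] H) :
    ℕ → (H →ₗ.[ℂ] H)
  | 0 => ofBounded (ContinuousLinearMap.id ℂ H)
  | n + 1 => mul (pow A n) A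

/-- A spectral measure on a measurable space `X` with values in the orthogonal projections of the
Hilbert space `H`: it is countably additive in the strong operator topology and `E(X) = I`.
(As with Mathlib's vector measures, non-measurable sets get the value `0`, so that equality of
spectral measures is equality on measurable sets.) -/
@[ext]
structure SpectralMeasure (X : Type*) [MeasurableSpace X] (H : Type*) [NormedAddCommGroup H]
    [InnerProductSpace ℂ H] [CompleteSpace H] where
  /-- the value of the spectral measure on a set -/
  proj : Set X → (H →L[ℂ] H)
  proj_of_not_measurableSet : ∀ s, ¬ MeasurableSet s → proj s = 0
  isStarProjection_proj : ∀ s, MeasurableSet s → IsStarProjection (proj s)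
  proj_univ : proj Set.univ = ContinuousLinearMap.id ℂ H
  hasSum_proj : ∀ s : ℕ → Set X, (∀ i, MeasurableSet (s i)) → Pairwise (Disjoint on s) →
    ∀ x : H, HasSum (fun i => proj (s i) x) (proj (⋃ i, s i) x)

namespace SpectralMeasure

variable {X : Type*} [MeasurableSpace X] {H : Type*} [NormedAddCommGroup H]
    [InnerProductSpace ℂ H] [CompleteSpace H]

theorem inner_proj_self (E : SpectralMeasure X H) {s : Set X} (hs : MeasurableSet s) (x : H) :
    ⟪x, E.proj s x⟫_ℂ = ((‖E.proj s x‖ ^ 2 : ℝ) : ℂ) := by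
  have h := E.isStarProjection_proj s hs
  have h1 : E.proj s (E.proj s x) = E.proj s x := congrArg (fun T => T x) h.isIdempotentElem
  have h2 := (ContinuousLinearMap.isSelfAdjoint_iff_isSymmetric.mp h.isSelfAdjoint)
    x (E.proj s x)
  simp only [ContinuousLinearMap.coe_coe] at h2
  rw [h1] at h2
  rw [← h2, inner_self_eq_norm_sq_to_K]
  norm_cast

theorem hasSum_norm_sq (E : SpectralMeasure X H) (s : ℕ → Set X) (hs : ∀ i, MeasurableSet (s i))
    (hd : Pairwise (Disjoint on s)) (x : H) :
    HasSum (fun i => ‖E.proj (s i) x‖ ^ 2) (‖E.proj (⋃ i, s i) x‖ ^ 2) := by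
  have h := (E.hasSum_proj s hs hd x).mapL (innerSL ℂ x)
  simp only [innerSL_apply_apply] at h
  rw [E.inner_proj_self (MeasurableSet.iUnion hs)] at h
  simp only [E.inner_proj_self (hs _)] at h
  exact_mod_cast h

theorem proj_empty_apply (E : SpectralMeasure X H) (x : H) : E.proj ∅ x = 0 := by
  have h := E.hasSum_proj (fun _ => ∅) (fun _ => MeasurableSet.empty)
    (fun _ _ _ => disjoint_bot_left) x
  exact tendsto_nhds_unique tendsto_const_nhds h.summable.tendsto_atTop_zero

/-- The finite positive measure `μ_x(s) = ⟨E(s) x, x⟩ = ‖E(s) x‖²`. -/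
def scalarMeasure (E : SpectralMeasure X H) (x : H) : Measure X :=
  Measure.ofMeasurable (fun s _ => ENNReal.ofReal (‖E.proj s x‖ ^ 2))
    (by simp [E.proj_empty_apply])
    (by
      intro s hs hd
      have h := E.hasSum_norm_sq s hs hd x
      rw [← ENNReal.ofReal_tsum_of_nonneg (fun _ => by positivity) h.summable, h.tsum_eq])

theorem scalarMeasure_apply (E : SpectralMeasure X H) (x : H) {s : Set X}
    (hs : MeasurableSet s) :
    E.scalarMeasure x s = ENNReal.ofReal (‖E.proj s x‖ ^ 2) :=
  Measure.ofMeasurable_apply s hs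

/-- `E.IsIntegral f A` means `A = ∫_X f dE`, for a real measurable function `f`: the domain of `A`
is `{x : ∫ |f|² dμ_x < ∞}`, and `⟨A x, x⟩ = ∫ f dμ_x` for all `x` in that domain, where
`μ_x = ⟨E(·) x, x⟩`. As the scalars are complex and the domain is dense, the operator `A` is
determined by its domain and its quadratic form. -/
structure IsIntegral (E : SpectralMeasure X H) (f : X → ℝ) (A : H →ₗ.[ℂ] H) : Prop where
  mem_domain_iff : ∀ x : H, x ∈ A.domain ↔ MemLp f 2 (E.scalarMeasure x)
  inner_apply : ∀ x : A.domain, ⟪(x : H), A x⟫_ℂ = ((∫ t, f t ∂(E.scalarMeasure x) : ℝ) : ℂ)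

end SpectralMeasure

/-- `M = |C|`: the positive selfadjoint operator `M` is the square root of `C* C`. -/
structure IsModulus {H : Type*} [NormedAddCommGroup H] [InnerProductSpace ℂ H] [CompleteSpace H]
    (M C : H →ₗ.[ℂ] H) : Prop where
  isSelfAdjoint : IsSelfAdjoint M
  nonneg : ∀ x : M.domain, 0 ≤ (⟪(x : H), M x⟫_ℂ).re
  mul_self : mul M M = mul C† C

/-- A closed densely defined operator `C` is quasinormal if `E(s) C ⊆ C E(s)` for every Borel set
`s ⊆ ℝ₊`, where `E` is the spectral measure of `|C|`, that is, the spectral measure on `ℝ₊` with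
`|C| = ∫ t E(dt)`. -/
def IsQuasinormal {H : Type*} [NormedAddCommGroup H] [InnerProductSpace ℂ H] [CompleteSpace H]
    (C : H →ₗ.[ℂ] H) : Prop :=
  C.IsClosed ∧ Dense (C.domain : Set H) ∧
    ∃ (M : H →ₗ.[ℂ] H) (E : SpectralMeasure ℝ≥0 H),
      IsModulus M C ∧ E.IsIntegral (fun t => (t : ℝ)) M ∧
        ∀ s : Set ℝ≥0, MeasurableSet s → mul (ofBounded (E.proj s)) C ≤ mul C (ofBounded (E.proj s))

end

end UnboundedOp

open UnboundedOp

/-!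
Operators are handled through their graphs, and `T = C* C` through its resolvent `R = (I + T)⁻¹`,
which von Neumann's projection argument provides (`exists_isResolvent_adjoint_mul_self`). All
conditions are compared with the single relation `R C ⊆ C R` (`Intertwines R C`).

* It implies `C*ⁿ Cⁿ = Tⁿ` for all `n`, since it lets factors `T` move past powers of `C`, and since
  `Tⁿ` has no proper symmetric extension (`Intertwines.pow_adjoint_mul_pow`).
* It follows from `C*ⁿ Cⁿ = Tⁿ` for `n = 2, 3`: for `x` in the domain of `T³`, the numbers
  `‖T C x‖²`, `‖C T x‖²` and `⟨T C x, C T x⟩` are all equal to `⟨T³ x, x⟩`, so `T C x = C T x`; the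
  domain of `T²` is a core for `C` (`intertwines_of_pow_adjoint_mul_pow`).
* It is equivalent to quasinormality. For a spectral measure `E` with `T = ∫ t dE` the identity
  `⟨x, Rⁿ x⟩ = ∫ (1 + t)⁻ⁿ dμ_x` holds, and finite measures on `[0, ∞)` are determined by the
  integrals of the functions `(1 + t)⁻ⁿ`. By polarization, `R C ⊆ C R` and `E(s) C ⊆ C E(s)` for all
  `s` are therefore both equalities between finite measures. The same moments give the uniqueness of
  `E` (`SpectralMeasure.eq_of_isIntegral`).

The conditions on spectral measures reduce to those on powers because `T = ∫ t dE` implies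
`Tⁿ = ∫ tⁿ dE` (`SpectralMeasure.IsIntegral.pow`). This and the moment identity rest on
`μ_{T x} = t² μ_x` and `μ_{(I + T) x} = (1 + t)² μ_x`, which are derived from the domain and the
quadratic form of `T` alone.

The spectral theorem itself (`IsResolvent.exists_isIntegral`) is obtained for `R` from the continuous
functional calculus and the Riesz-Markov-Kakutani theorem, and transported to `T` by the substitution
`t = r⁻¹ - 1`. The square root `|C|` of `T` is constructed from square roots of `R` and `I - R`
(`IsResolvent.exists_sqrt`).
-/

open Filter Topology

namespace UnboundedOp

noncomputable section

section Graphs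

variable {H : Type*} [NormedAddCommGroup H] [InnerProductSpace ℂ H]

/-! ### Graphs of products, powers and adjoints -/

theorem re_inner_self (x : H) : (⟪x, x⟫_ℂ).re = ‖x‖ ^ 2 :=
  inner_self_eq_norm_sq (𝕜 := ℂ) x

theorem mem_graph_mul {A B : H →ₗ.[ℂ] H} {x z : H} :
    (x, z) ∈ (mul A B).graph ↔ ∃ y, (x, y) ∈ B.graph ∧ (y, z) ∈ A.graph := by
  simp only [LinearPMap.mem_graph_iff]
  constructor
  · rintro ⟨⟨u, hu⟩, rfl, h⟩
    obtain ⟨h1, h2⟩ := mem_mul_domain.mp hu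
    exact ⟨B ⟨u, h1⟩, ⟨⟨u, h1⟩, rfl, rfl⟩, ⟨B ⟨u, h1⟩, h2⟩, rfl, h⟩
  · rintro ⟨y, ⟨⟨u, hu⟩, rfl, rfl⟩, ⟨v, hv⟩, h, rfl⟩
    obtain rfl : v = _ := h
    exact ⟨⟨u, mem_mul_domain.mpr ⟨hu, hv⟩⟩, rfl, rfl⟩

theorem mem_graph_ofBounded {T : H →L[ℂ] H} {x y : H} :
    (x, y) ∈ (ofBounded T).graph ↔ T x = y := by
  simp only [LinearPMap.mem_graph_iff]
  constructor
  · rintro ⟨u, rfl, h⟩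
    exact h
  · intro h
    exact ⟨⟨x, trivial⟩, rfl, h⟩

theorem mem_graph_pow_zero {A : H →ₗ.[ℂ] H} {x y : H} : (x, y) ∈ (pow A 0).graph ↔ x = y :=
  mem_graph_ofBounded

theorem mem_graph_pow_succ {A : H →ₗ.[ℂ] H} {n : ℕ} {x z : H} :
    (x, z) ∈ (pow A (n + 1)).graph ↔ ∃ y, (x, y) ∈ A.graph ∧ (y, z) ∈ (pow A n).graph :=
  mem_graph_mul

theorem mem_graph_pow_one {A : H →ₗ.[ℂ] H} {x y : H} :
    (x, y) ∈ (pow A 1).graph ↔ (x, y) ∈ A.graph := by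
  rw [mem_graph_pow_succ]
  simp only [mem_graph_pow_zero, exists_eq_right]

theorem mem_graph_pow_succ' {A : H →ₗ.[ℂ] H} {n : ℕ} {x z : H} :
    (x, z) ∈ (pow A (n + 1)).graph ↔ ∃ y, (x, y) ∈ (pow A n).graph ∧ (y, z) ∈ A.graph := by
  induction n generalizing x with
  | zero =>
    rw [mem_graph_pow_one]
    simp only [mem_graph_pow_zero, exists_eq_left']
  | succ n ih =>
    rw [mem_graph_pow_succ]
    constructor
    · rintro ⟨y, hy, h⟩
      obtain ⟨w, hw, h⟩ := ih.mp h
      exact ⟨w, mem_graph_pow_succ.mpr ⟨y, hy, hw⟩, h⟩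
    · rintro ⟨w, hw, h⟩
      obtain ⟨y, hy, hw⟩ := mem_graph_pow_succ.mp hw
      exact ⟨y, hy, ih.mpr ⟨w, hw, h⟩⟩

theorem eq_of_mem_graph {A : H →ₗ.[ℂ] H} {x y z : H} (h : (x, y) ∈ A.graph)
    (h' : (x, z) ∈ A.graph) : y = z :=
  A.mem_graph_snd_inj h h' rfl

theorem ext_graph {A B : H →ₗ.[ℂ] H} (h : ∀ x y, (x, y) ∈ A.graph ↔ (x, y) ∈ B.graph) : A = B :=
  LinearPMap.eq_of_eq_graph (by ext ⟨x, y⟩; exact h x y)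

theorem mem_graph_adjoint [CompleteSpace H] {C : H →ₗ.[ℂ] H} (hd : Dense (C.domain : Set H))
    {y z : H} :
    (y, z) ∈ C†.graph ↔ ∀ a b, (a, b) ∈ C.graph → ⟪b, y⟫_ℂ = ⟪a, z⟫_ℂ := by
  rw [LinearPMap.adjoint_graph_eq_graph_adjoint hd, Submodule.mem_adjoint_iff]
  simp only [sub_eq_zero]

/-- The powers of `C†` and `C` are formal adjoints of each other. -/
theorem inner_pow_adjoint [CompleteSpace H] {C : H →ₗ.[ℂ] H} (hd : Dense (C.domain : Set H))
    {n : ℕ} {a b y z : H} (hab : (a, b) ∈ (pow C n).graph) (hyz : (y, z) ∈ (pow C† n).graph) :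
    ⟪b, y⟫_ℂ = ⟪a, z⟫_ℂ := by
  induction n generalizing a z with
  | zero =>
    rw [mem_graph_pow_zero] at hab hyz
    rw [hab, hyz]
  | succ n ih =>
    obtain ⟨c, hc, hcb⟩ := mem_graph_pow_succ.mp hab
    obtain ⟨w, hw, hwz⟩ := mem_graph_pow_succ'.mp hyz
    rw [ih hcb hw]
    exact (mem_graph_adjoint hd).mp hwz a c hc

/-! ### The orthogonal projection onto the graph of a closed operator -/

theorem exists_graph_projection [CompleteSpace H] {C : H →ₗ.[ℂ] H} (hC : C.IsClosed) (h k : H) :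
    ∃ a b, (a, b) ∈ C.graph ∧
      ∀ y w, (y, w) ∈ C.graph → ⟪h - a, y⟫_ℂ + ⟪k - b, w⟫_ℂ = 0 := by
  let L : WithLp 2 (H × H) ≃L[ℂ] H × H := WithLp.prodContinuousLinearEquiv 2 ℂ H H
  let G : Submodule ℂ (WithLp 2 (H × H)) := C.graph.comap (L : WithLp 2 (H × H) →ₗ[ℂ] H × H)
  have hG : IsClosed (G : Set (WithLp 2 (H × H))) := by
    have : IsClosed (C.graph : Set (H × H)) := hC
    exact this.preimage L.continuous
  have : CompleteSpace G := hG.completeSpace_coe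
  obtain ⟨g, hg, v, hv, hgv⟩ := G.exists_add_mem_mem_orthogonal (WithLp.toLp 2 (h, k))
  refine ⟨g.fst, g.snd, hg, fun y w hyw => ?_⟩
  have h1 := (Submodule.mem_orthogonal' G v).mp hv (WithLp.toLp 2 (y, w)) hyw
  have h2 : v = WithLp.toLp 2 (h - g.fst, k - g.snd) := by
    rw [← add_sub_cancel_left g v, ← hgv]
    rfl
  rw [h2, WithLp.prod_inner_apply] at h1
  exact h1

/-- The graph of a closed operator is the annihilator of its annihilator. -/
theorem mem_graph_of_forall_annihilator [CompleteSpace H] {C : H →ₗ.[ℂ] H} (hC : C.IsClosed)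
    {a b : H}
    (h : ∀ p q, (∀ y w, (y, w) ∈ C.graph → ⟪p, y⟫_ℂ + ⟪q, w⟫_ℂ = 0) →
      (⟪p, a⟫_ℂ + ⟪q, b⟫_ℂ).re = 0) : (a, b) ∈ C.graph := by
  obtain ⟨c, d, hcd, horth⟩ := exists_graph_projection hC a b
  have h1 := h _ _ horth
  have h2 := horth c d hcd
  have h3 : (⟪a - c, a - c⟫_ℂ + ⟪b - d, b - d⟫_ℂ).re = 0 := by
    rw [inner_sub_right, inner_sub_right, sub_add_sub_comm, h2, sub_zero, h1]
  rw [Complex.add_re, re_inner_self, re_inner_self] at h3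
  have h4 : a - c = 0 := by
    rw [← norm_eq_zero, ← sq_eq_zero_iff]
    nlinarith [sq_nonneg ‖a - c‖, sq_nonneg ‖b - d‖]
  have h5 : b - d = 0 := by
    rw [← norm_eq_zero, ← sq_eq_zero_iff]
    nlinarith [sq_nonneg ‖a - c‖, sq_nonneg ‖b - d‖]
  rwa [sub_eq_zero.mp h4, sub_eq_zero.mp h5]

/-! ### The resolvent at `-1` of a positive selfadjoint operator -/

/-- `IsResolvent R T` says that `R = (I + T)⁻¹`, in terms of the graph of `T`, and that the
bounded operator `R` is selfadjoint with `0 ≤ R² ≤ R`. Thus `T` is positive and selfadjoint. -/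
structure IsResolvent [CompleteSpace H] (R : H →L[ℂ] H) (T : H →ₗ.[ℂ] H) : Prop where
  isSelfAdjoint : IsSelfAdjoint R
  norm_sq_le : ∀ x, ‖R x‖ ^ 2 ≤ (⟪x, R x⟫_ℂ).re
  mem_graph : ∀ x y, (x, y) ∈ T.graph ↔ R (x + y) = x

namespace IsResolvent

variable [CompleteSpace H] {R : H →L[ℂ] H} {T : H →ₗ.[ℂ] H}

theorem inner_comm (hR : IsResolvent R T) (x y : H) : ⟪R x, y⟫_ℂ = ⟪x, R y⟫_ℂ :=
  ContinuousLinearMap.isSelfAdjoint_iff_isSymmetric.mp hR.isSelfAdjoint x y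

theorem apply_mem_graph (hR : IsResolvent R T) (x : H) : (R x, x - R x) ∈ T.graph := by
  rw [hR.mem_graph, add_sub_cancel]

theorem injective (hR : IsResolvent R T) : Function.Injective R := by
  rw [injective_iff_map_eq_zero]
  intro x hx
  have h := hR.apply_mem_graph x
  rw [hx, sub_zero] at h
  exact T.graph_fst_eq_zero_snd h rfl

theorem eq_zero_of_forall_inner_apply (hR : IsResolvent R T) {z : H}
    (h : ∀ x, ⟪z, R x⟫_ℂ = 0) : z = 0 := by
  apply hR.injective
  rw [map_zero, ← inner_self_eq_zero (𝕜 := ℂ), hR.inner_comm, h]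

theorem dense_domain (hR : IsResolvent R T) : Dense (T.domain : Set H) := by
  rw [Submodule.dense_iff_topologicalClosure_eq_top, Submodule.topologicalClosure_eq_top_iff,
    Submodule.eq_bot_iff]
  intro z hz
  refine hR.eq_zero_of_forall_inner_apply fun x => ?_
  exact (Submodule.mem_orthogonal' _ z).mp hz _ (LinearPMap.mem_domain_of_mem_graph
    (hR.apply_mem_graph x))

theorem symmetric (hR : IsResolvent R T) {x y z w : H} (hx : (x, y) ∈ T.graph)
    (hz : (z, w) ∈ T.graph) : ⟪y, z⟫_ℂ = ⟪x, w⟫_ℂ := by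
  rw [hR.mem_graph] at hx hz
  have h := hR.inner_comm (x + y) (z + w)
  rw [hx, hz, inner_add_left, inner_add_right] at h
  exact (add_left_cancel h).symm

theorem nonneg (hR : IsResolvent R T) {x y : H} (hx : (x, y) ∈ T.graph) :
    0 ≤ (⟪x, y⟫_ℂ).re := by
  rw [hR.mem_graph] at hx
  have h := hR.norm_sq_le (x + y)
  rw [← hR.inner_comm, hx, inner_add_right, Complex.add_re, re_inner_self] at h
  simpa using h

theorem selfAdjoint (hR : IsResolvent R T) : IsSelfAdjoint T := by
  rw [LinearPMap.isSelfAdjoint_def]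
  refine ext_graph fun x y => ?_
  rw [mem_graph_adjoint hR.dense_domain]
  constructor
  · intro h
    rw [hR.mem_graph]
    refine ext_inner_left ℂ fun v => ?_
    have h1 := h _ _ (hR.apply_mem_graph v)
    rw [inner_sub_left, sub_eq_iff_eq_add] at h1
    rw [h1, ← hR.inner_comm, inner_add_right, add_comm]
  · intro h a b hab
    exact hR.symmetric hab h

end IsResolvent

theorem isSelfAdjoint_of_inner_real [CompleteSpace H] {B : H →L[ℂ] H}
    (h : ∀ x, (⟪x, B x⟫_ℂ).im = 0) : IsSelfAdjoint B := by
  rw [ContinuousLinearMap.isSelfAdjoint_iff_isSymmetric, LinearMap.isSymmetric_iff_inner_map_self_real]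
  intro x
  rw [inner_conj_symm]
  conv_rhs => rw [← inner_conj_symm]
  exact (Complex.conj_eq_iff_im.mpr (h x)).symm

/-- **von Neumann's theorem**: for a closed densely defined operator `C`, the operator `C* C` is
positive and selfadjoint. The resolvent of `C* C` at `h` is the first component of the projection
of `(h, 0)` onto the graph of `C`. -/
theorem exists_isResolvent_adjoint_mul_self [CompleteSpace H] {C : H →ₗ.[ℂ] H} (hC : C.IsClosed)
    (hd : Dense (C.domain : Set H)) : ∃ R : H →L[ℂ] H, IsResolvent R (mul C† C) := by
  have hpos : ∀ x y, (x, y) ∈ (mul C† C).graph → ∃ b, (x, b) ∈ C.graph ∧ ⟪x, y⟫_ℂ = ⟪b, b⟫_ℂ := by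
    intro x y hxy
    obtain ⟨b, hb, hby⟩ := mem_graph_mul.mp hxy
    exact ⟨b, hb, ((mem_graph_adjoint hd).mp hby _ _ hb).symm⟩
  have hle : ∀ x y, (x, y) ∈ (mul C† C).graph → ‖x‖ ^ 2 ≤ (⟪x, x + y⟫_ℂ).re := by
    intro x y hxy
    obtain ⟨b, -, hb⟩ := hpos x y hxy
    rw [inner_add_right, hb, Complex.add_re, re_inner_self, re_inner_self]
    nlinarith [sq_nonneg ‖b‖]
  have hle' : ∀ x y, (x, y) ∈ (mul C† C).graph → ‖x‖ ≤ ‖x + y‖ := by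
    intro x y hxy
    have h1 := hle x y hxy
    have h2 : (⟪x, x + y⟫_ℂ).re ≤ ‖x‖ * ‖x + y‖ := re_inner_le_norm (𝕜 := ℂ) x (x + y)
    by_contra hcon
    push Not at hcon
    nlinarith [norm_nonneg (x + y), norm_nonneg x]
  have huniq : ∀ x y x' y', (x, y) ∈ (mul C† C).graph → (x', y') ∈ (mul C† C).graph →
      x + y = x' + y' → x = x' := by
    intro x y x' y' h h' he
    have h1 := hle' _ _ ((mul C† C).graph.sub_mem h h')
    have h2 : (x - x') + (y - y') = 0 := by rw [sub_add_sub_comm, he, sub_self]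
    simp only [h2, norm_zero] at h1
    exact sub_eq_zero.mp (norm_le_zero_iff.mp h1)
  have hex : ∀ h, ∃ x, (x, h - x) ∈ (mul C† C).graph := by
    intro h
    obtain ⟨a, b, hab, horth⟩ := exists_graph_projection hC h 0
    refine ⟨a, mem_graph_mul.mpr ⟨b, hab, (mem_graph_adjoint hd).mpr fun y w hyw => ?_⟩⟩
    have h1 := horth y w hyw
    rw [zero_sub, inner_neg_left, ← sub_eq_add_neg, sub_eq_zero] at h1
    rw [← inner_conj_symm, ← h1, inner_conj_symm]
  choose r hr using hex
  let R₀ : H →ₗ[ℂ] H :=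
    { toFun := r
      map_add' := fun x y => by
        refine huniq _ _ _ _ (hr (x + y)) ((mul C† C).graph.add_mem (hr x) (hr y)) ?_
        dsimp only
        abel
      map_smul' := fun c x => by
        refine huniq _ _ _ _ (hr (c • x)) ((mul C† C).graph.smul_mem c (hr x)) ?_
        dsimp only
        rw [smul_sub]
        simp }
  let R : H →L[ℂ] H := R₀.mkContinuous 1 fun x => by
    have := hle' _ _ (hr x)
    rw [add_sub_cancel] at this
    rw [one_mul]
    exact this
  have hRr : ∀ x, R x = r x := fun x => rfl
  have hself : IsSelfAdjoint R := by
    refine isSelfAdjoint_of_inner_real fun x => ?_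
    obtain ⟨b, -, hb⟩ := hpos _ _ (hr x)
    have h1 : ⟪R x, x⟫_ℂ = ⟪R x, R x⟫_ℂ + ⟪b, b⟫_ℂ := by
      rw [← hb, hRr, ← inner_add_right, add_sub_cancel]
    rw [← inner_conj_symm, h1, inner_self_eq_norm_sq_to_K, inner_self_eq_norm_sq_to_K,
      Complex.conj_im]
    simp [← Complex.ofReal_pow]
  refine ⟨R, hself, fun x => ?_, fun x y => ⟨fun h => ?_, fun h => ?_⟩⟩
  · have h1 := hle _ _ (hr x)
    rw [add_sub_cancel] at h1
    rw [hRr, ← inner_conj_symm, Complex.conj_re]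
    exact h1
  · exact huniq _ _ _ _ (hr (x + y)) h (add_sub_cancel _ _)
  · have h1 := hr (x + y)
    rw [← hRr, h, add_sub_cancel_left] at h1
    exact h1

end Graphs

section Powers

/-! ### Powers of a positive selfadjoint operator -/

namespace IsResolvent

variable {H : Type*} [NormedAddCommGroup H] [InnerProductSpace ℂ H] [CompleteSpace H]
  {R : H →L[ℂ] H} {T : H →ₗ.[ℂ] H}

omit [CompleteSpace H] in
theorem exists_one_sub_pow_apply (n : ℕ) (z : H) : ∃ v, ((1 - R) ^ n) z = z - R v := by
  induction n with
  | zero => exact ⟨0, by simp⟩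
  | succ n ih =>
    obtain ⟨v, hv⟩ := ih
    refine ⟨v + z - R v, ?_⟩
    rw [pow_succ', mul_apply_eq_comp, hv]
    simp only [sub_apply, one_apply_eq_self, map_sub, map_add]
    abel

/-- The graph of `Tⁿ`, from the identity `Tⁿ (I + T)⁻ⁿ = (I - (I + T)⁻¹)ⁿ`. -/
theorem mem_graph_pow_iff (hR : IsResolvent R T) {n : ℕ} {x z : H} :
    (x, z) ∈ (UnboundedOp.pow T n).graph ↔ (R ^ n) z = ((1 - R) ^ n) x := by
  have hcomm : Commute R (1 - R) := (Commute.one_right R).sub_right (Commute.refl R)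
  have key : ∀ (n : ℕ) (y : H), ((1 - R) ^ (n + 1)) (R y) = R (((1 - R) ^ n) (y - R y)) := by
    intro n y
    have h := (hcomm.pow_right (n + 1)).eq
    have h' := congrArg (fun B => B y) h
    simp only [mul_apply_eq_comp] at h'
    rw [← h', pow_succ, mul_apply_eq_comp]
    rfl
  induction n generalizing x with
  | zero =>
    rw [mem_graph_pow_zero]
    exact eq_comm
  | succ n ih =>
    rw [mem_graph_pow_succ]
    constructor
    · rintro ⟨y, hy, h⟩
      replace h := ih.mp h
      rw [hR.mem_graph] at hy
      have h1 := key n (x + y)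
      rw [hy, add_sub_cancel_left, ← h] at h1
      rw [h1, pow_succ', mul_apply_eq_comp]
    · intro h
      obtain ⟨v, hv⟩ := exists_one_sub_pow_apply (R := R) (n + 1) x
      rw [hv, pow_succ', mul_apply_eq_comp] at h
      obtain ⟨x', rfl⟩ : ∃ x', x = R x' := ⟨(R ^ n) z + v, by rw [map_add, h, sub_add_cancel]⟩
      refine ⟨x' - R x', hR.apply_mem_graph x', ih.mpr (hR.injective ?_)⟩
      rw [h, ← hv, key]

/-- `Tⁿ` has no proper symmetric extension: test the hypothesis on the vectors `x = Rⁿ v`. -/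
theorem mem_graph_pow_of_symmetric (hR : IsResolvent R T) {n : ℕ} {z a : H}
    (h : ∀ x y, (x, y) ∈ (UnboundedOp.pow T n).graph → ⟪a, x⟫_ℂ = ⟪z, y⟫_ℂ) :
    (z, a) ∈ (UnboundedOp.pow T n).graph := by
  rw [hR.mem_graph_pow_iff]
  have h1 : IsSelfAdjoint (R ^ n) := hR.isSelfAdjoint.pow n
  have h2 : IsSelfAdjoint ((1 - R) ^ n) := ((IsSelfAdjoint.one _).sub hR.isSelfAdjoint).pow n
  have hcomm : Commute (R ^ n) ((1 - R) ^ n) :=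
    ((Commute.one_right R).sub_right (Commute.refl R)).pow_pow n n
  refine ext_inner_right ℂ fun v => ?_
  rw [ContinuousLinearMap.isSelfAdjoint_iff_isSymmetric] at h1 h2
  have h3 := h ((R ^ n) v) (((1 - R) ^ n) v) (by
    rw [hR.mem_graph_pow_iff]
    exact congrArg (fun B => B v) hcomm.eq)
  exact (h1 a v).trans (h3.trans (h2 z v).symm)

end IsResolvent

/-! ### Operators intertwined with the resolvent -/

variable {H : Type*} [NormedAddCommGroup H] [InnerProductSpace ℂ H]

/-- `B` commutes with `C` in the sense that `B C ⊆ C B`, that is, `B × B` leaves the graph of `C`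
invariant. -/
def Intertwines (B : H →L[ℂ] H) (C : H →ₗ.[ℂ] H) : Prop :=
  ∀ x y, (x, y) ∈ C.graph → (B x, B y) ∈ C.graph

theorem intertwines_iff {B : H →L[ℂ] H} {C : H →ₗ.[ℂ] H} :
    Intertwines B C ↔ mul (ofBounded B) C ≤ mul C (ofBounded B) := by
  rw [← LinearPMap.le_graph_iff]
  constructor
  · rintro h ⟨x, z⟩ hxz
    obtain ⟨y, hy, hyz⟩ := mem_graph_mul.mp hxz
    rw [mem_graph_ofBounded] at hyz
    exact mem_graph_mul.mpr ⟨B x, mem_graph_ofBounded.mpr rfl, hyz ▸ h x y hy⟩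
  · intro h x y hxy
    have h1 : (x, B y) ∈ (mul (ofBounded B) C).graph :=
      mem_graph_mul.mpr ⟨y, hxy, mem_graph_ofBounded.mpr rfl⟩
    obtain ⟨w, hw, hwy⟩ := mem_graph_mul.mp (h h1)
    rw [mem_graph_ofBounded] at hw
    rwa [hw]

theorem Intertwines.pow {B : H →L[ℂ] H} {C : H →ₗ.[ℂ] H} (h : Intertwines B C) (n : ℕ) :
    Intertwines (B ^ n) C := by
  induction n with
  | zero => exact fun x y hxy => hxy
  | succ n ih =>
    intro x y hxy
    rw [pow_succ', mul_apply_eq_comp, mul_apply_eq_comp]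
    exact h _ _ (ih _ _ hxy)

variable [CompleteSpace H] {C : H →ₗ.[ℂ] H} {R : H →L[ℂ] H}

/-- If the resolvent of `T = C* C` intertwines `C`, then `Cⁿ T x = T Cⁿ x` whenever the left hand
side is defined. -/
theorem Intertwines.exists_pow_comm (hR : IsResolvent R (mul C† C)) (h : Intertwines R C) {n : ℕ}
    {x y z : H} (hxy : (x, y) ∈ (mul C† C).graph) (hyz : (y, z) ∈ (UnboundedOp.pow C n).graph) :
    ∃ w, (x, w) ∈ (UnboundedOp.pow C n).graph ∧ (w, z) ∈ (mul C† C).graph := by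
  induction n generalizing x y with
  | zero =>
    rw [mem_graph_pow_zero] at hyz
    exact ⟨x, mem_graph_pow_zero.mpr rfl, hyz ▸ hxy⟩
  | succ n ih =>
    obtain ⟨u, hu, huz⟩ := mem_graph_pow_succ.mp hyz
    obtain ⟨b, hb, -⟩ := mem_graph_mul.mp hxy
    have h1 := h _ _ (C.graph.add_mem hb hu)
    have h2 : R (x + y) = x := (hR.mem_graph x y).mp hxy
    have h3 : R (b + u) = b := eq_of_mem_graph h1 (by simpa only [h2] using hb)
    obtain ⟨w, hw, hwz⟩ := ih ((hR.mem_graph b u).mpr h3) huz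
    exact ⟨w, mem_graph_pow_succ.mpr ⟨b, hb, hw⟩, hwz⟩

/-- If the resolvent of `C* C` intertwines `C`, then `C*ⁿ Cⁿ = (C* C)ⁿ`: the inclusion `⊇` follows
by commuting one factor `C* C` at a time past a power of `C`, and the right hand side has no proper
symmetric extension. -/
theorem Intertwines.pow_adjoint_mul_pow (hd : Dense (C.domain : Set H))
    (hR : IsResolvent R (mul C† C)) (h : Intertwines R C) (n : ℕ) :
    mul (UnboundedOp.pow C† n) (UnboundedOp.pow C n) = UnboundedOp.pow (mul C† C) n := by
  have hle : ∀ n x z, (x, z) ∈ (UnboundedOp.pow (mul C† C) n).graph →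
      (x, z) ∈ (mul (UnboundedOp.pow C† n) (UnboundedOp.pow C n)).graph := by
    intro n
    induction n with
    | zero =>
      intro x z hxz
      rw [mem_graph_pow_zero] at hxz
      exact mem_graph_mul.mpr ⟨x, mem_graph_pow_zero.mpr rfl, mem_graph_pow_zero.mpr hxz⟩
    | succ n ih =>
      intro x z hxz
      obtain ⟨y, hxy, hyz⟩ := mem_graph_pow_succ.mp hxz
      obtain ⟨v, hyv, hvz⟩ := mem_graph_mul.mp (ih y z hyz)
      obtain ⟨w, hxw, hwv⟩ := h.exists_pow_comm hR hxy hyv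
      obtain ⟨u, hwu, huv⟩ := mem_graph_mul.mp hwv
      exact mem_graph_mul.mpr
        ⟨u, mem_graph_pow_succ'.mpr ⟨w, hxw, hwu⟩, mem_graph_pow_succ.mpr ⟨v, huv, hvz⟩⟩
  refine ext_graph fun z a => ⟨fun hza => hR.mem_graph_pow_of_symmetric fun x y hxy => ?_, hle n z a⟩
  obtain ⟨b, hzb, hba⟩ := mem_graph_mul.mp hza
  obtain ⟨c, hxc, hcy⟩ := mem_graph_mul.mp (hle n x y hxy)
  rw [← inner_conj_symm, ← inner_pow_adjoint hd hxc hba, inner_conj_symm,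
    inner_pow_adjoint hd hzb hcy]

/-- Write `T = C* C`. If `C*ⁿ Cⁿ = Tⁿ` for `n = 2, 3`, then `T C x = C T x`
for `x` in the domain of `T³`, because `‖T C x‖² = ‖C T x‖² = ⟨T C x, C T x⟩ = ⟨T³ x, x⟩`. -/
theorem exists_comm_of_pow_adjoint_mul_pow (hd : Dense (C.domain : Set H))
    (hR : IsResolvent R (mul C† C))
    (h2 : mul (pow C† 2) (pow C 2) = pow (mul C† C) 2)
    (h3 : mul (pow C† 3) (pow C 3) = pow (mul C† C) 3) {x y y₂ y₃ : H}
    (hxy : (x, y) ∈ (mul C† C).graph) (hy : (y, y₂) ∈ (mul C† C).graph)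
    (hy₂ : (y₂, y₃) ∈ (mul C† C).graph) :
    ∃ w c, (x, w) ∈ C.graph ∧ (y, c) ∈ C.graph ∧ (w, c) ∈ (mul C† C).graph := by
  have two : ∀ {A : H →ₗ.[ℂ] H} {a b c : H}, (a, b) ∈ A.graph → (b, c) ∈ A.graph →
      (a, c) ∈ (pow A 2).graph := fun hab hbc =>
    mem_graph_pow_succ.mpr ⟨_, hab, mem_graph_pow_one.mpr hbc⟩
  have two' : ∀ {A : H →ₗ.[ℂ] H} {a c : H}, (a, c) ∈ (pow A 2).graph →
      ∃ b, (a, b) ∈ A.graph ∧ (b, c) ∈ A.graph := fun h => by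
    obtain ⟨b, hab, hbc⟩ := mem_graph_pow_succ.mp h
    exact ⟨b, hab, mem_graph_pow_one.mp hbc⟩
  have hx3 : (x, y₃) ∈ (mul (pow C† 3) (pow C 3)).graph := by
    rw [h3]
    exact mem_graph_pow_succ.mpr ⟨y, hxy, two hy hy₂⟩
  have hx2 : (x, y₂) ∈ (mul (pow C† 2) (pow C 2)).graph := by
    rw [h2]
    exact two hxy hy
  obtain ⟨w₃, hxw₃, hw₃⟩ := mem_graph_mul.mp hx3
  obtain ⟨w, hxw, hww₃⟩ := mem_graph_pow_succ.mp hxw₃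
  obtain ⟨w₂, hww₂, hw₂w₃⟩ := two' hww₃
  obtain ⟨v₂, hw₃v₂, hv₂⟩ := mem_graph_pow_succ'.mp hw₃
  obtain ⟨w₂', hxw₂', hw₂'⟩ := mem_graph_mul.mp hx2
  obtain rfl : w₂ = w₂' := eq_of_mem_graph (two hxw hww₂) hxw₂'
  obtain ⟨u, hw₂u, huy₂⟩ := two' hw₂'
  have hwu : (w, u) ∈ (mul C† C).graph := mem_graph_mul.mpr ⟨w₂, hww₂, hw₂u⟩
  have hwv₂ : (w, v₂) ∈ (pow (mul C† C) 2).graph := by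
    rw [← h2]
    exact mem_graph_mul.mpr ⟨w₃, two hww₂ hw₂w₃, hw₃v₂⟩
  obtain ⟨u', hwu', hu'v₂⟩ := two' hwv₂
  obtain rfl : u = u' := eq_of_mem_graph hwu hwu'
  obtain ⟨c, hyc, hcy₂⟩ := mem_graph_mul.mp hy
  have e1 : ⟪u, u⟫_ℂ = ⟪y, y₂⟫_ℂ := by
    rw [hR.symmetric hwu hu'v₂, (mem_graph_adjoint hd).mp hv₂ _ _ hxw, hR.symmetric hxy hy₂]
  have e2 : ⟪c, c⟫_ℂ = ⟪y, y₂⟫_ℂ := (mem_graph_adjoint hd).mp hcy₂ _ _ hyc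
  have e3 : ⟪c, u⟫_ℂ = ⟪y, y₂⟫_ℂ := (mem_graph_adjoint hd).mp huy₂ _ _ hyc
  have e4 : ⟪u, c⟫_ℂ = ⟪y, y₂⟫_ℂ := by
    rw [← inner_conj_symm, e3, ← e2, inner_conj_symm]
  have huc : u = c := by
    rw [← sub_eq_zero, ← inner_self_eq_zero (𝕜 := ℂ), inner_sub_left, inner_sub_right,
      inner_sub_right, e1, e2, e3, e4, sub_self]
  exact ⟨w, c, hxw, hyc, huc ▸ hwu⟩

/-- If `C*ⁿ Cⁿ = (C* C)ⁿ` for `n = 2, 3`, then the resolvent `R` of `C* C` intertwines `C`. This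
holds on the domain of `(C* C)²`, which is a core for `C`: a vector `(a, C a)` of the graph that is
orthogonal to all `(R² v, C R² v)` satisfies `⟨a, R v⟩ = 0` for all `v`. -/
theorem intertwines_of_pow_adjoint_mul_pow (hC : C.IsClosed) (hd : Dense (C.domain : Set H))
    (hR : IsResolvent R (mul C† C))
    (h2 : mul (pow C† 2) (pow C 2) = pow (mul C† C) 2)
    (h3 : mul (pow C† 3) (pow C 3) = pow (mul C† C) 3) : Intertwines R C := by
  have hcore : ∀ v w, (R (R v), w) ∈ C.graph → (R (R (R v)), R w) ∈ C.graph := by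
    intro v w hvw
    set x₀ := R (R v) with hx₀
    have t0 : (R x₀, x₀ - R x₀) ∈ (mul C† C).graph := hR.apply_mem_graph x₀
    have t1 : (x₀, R v - x₀) ∈ (mul C† C).graph := hR.apply_mem_graph (R v)
    have t2 : (R v - x₀, v - R v - (R v - x₀)) ∈ (mul C† C).graph :=
      (mul C† C).graph.sub_mem (hR.apply_mem_graph v) t1
    have t3 := (mul C† C).graph.sub_mem t1 t0
    have t4 := (mul C† C).graph.sub_mem t2 t3
    obtain ⟨w', c, hw', hc, hw'c⟩ := exists_comm_of_pow_adjoint_mul_pow hd hR h2 h3 t0 t3 t4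
    have h5 := C.graph.add_mem hw' hc
    rw [Prod.mk_add_mk, add_sub_cancel] at h5
    have h6 : w' + c = w := eq_of_mem_graph h5 hvw
    rw [hR.mem_graph, h6] at hw'c
    rwa [hw'c]
  intro y w hyw
  refine mem_graph_of_forall_annihilator hC fun p q hpq => ?_
  obtain ⟨a, b, hab, horth⟩ := exists_graph_projection hC (R p) (R q)
  have ha : a = 0 := by
    refine hR.eq_zero_of_forall_inner_apply fun v => ?_
    obtain ⟨u, hu, huv⟩ := mem_graph_mul.mp (hR.apply_mem_graph (R v))
    have e1 := horth _ _ hu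
    have e2 := hpq _ _ (hcore v u hu)
    rw [inner_sub_left, inner_sub_left, hR.inner_comm p, hR.inner_comm q, sub_add_sub_comm, e2,
      zero_sub, neg_eq_zero, (mem_graph_adjoint hd).mp huv _ _ hab, ← inner_add_right,
      add_sub_cancel] at e1
    exact e1
  subst ha
  have hb : b = 0 := C.graph_fst_eq_zero_snd hab rfl
  subst hb
  have e1 := horth y w hyw
  rw [sub_zero, sub_zero, hR.inner_comm, hR.inner_comm] at e1
  rw [e1, Complex.zero_re]

end Powers

section Spectral

/-! ### Spectral measures -/

theorem iUnion_abs_le {X : Type*} (f : X → ℝ) : ⋃ n : ℕ, {t | |f t| ≤ n} = Set.univ :=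
  Set.eq_univ_of_forall fun t => Set.mem_iUnion.mpr (exists_nat_ge |f t|)

namespace SpectralMeasure

variable {X : Type*} [MeasurableSpace X] {H : Type*} [NormedAddCommGroup H]
    [InnerProductSpace ℂ H] [CompleteSpace H] (E : SpectralMeasure X H)

theorem inner_proj_comm {s : Set X} (hs : MeasurableSet s) (x y : H) :
    ⟪E.proj s x, y⟫_ℂ = ⟪x, E.proj s y⟫_ℂ :=
  ContinuousLinearMap.isSelfAdjoint_iff_isSymmetric.mp (E.isStarProjection_proj s hs).isSelfAdjoint
    x y

theorem proj_proj_self {s : Set X} (hs : MeasurableSet s) (x : H) :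
    E.proj s (E.proj s x) = E.proj s x :=
  congrArg (fun T => T x) (E.isStarProjection_proj s hs).isIdempotentElem

theorem inner_proj_proj {s : Set X} (hs : MeasurableSet s) (x y : H) :
    ⟪E.proj s x, E.proj s y⟫_ℂ = ⟪E.proj s x, y⟫_ℂ := by
  rw [← E.inner_proj_comm hs, E.proj_proj_self hs]

theorem proj_univ_apply (x : H) : E.proj Set.univ x = x := by
  rw [E.proj_univ]
  rfl

/-- The vector measure `s ↦ E(s) x`. -/
def vectorMeasure (x : H) : VectorMeasure X H where
  measureOf' s := E.proj s x
  empty' := E.proj_empty_apply x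
  not_measurable' s hs := by rw [E.proj_of_not_measurableSet s hs]; rfl
  m_iUnion' s hs hd := E.hasSum_proj s hs hd x

theorem proj_union {s t : Set X} (hs : MeasurableSet s) (ht : MeasurableSet t)
    (h : Disjoint s t) (x : H) : E.proj (s ∪ t) x = E.proj s x + E.proj t x :=
  (E.vectorMeasure x).of_union h hs ht

theorem proj_compl {s : Set X} (hs : MeasurableSet s) (x : H) :
    E.proj sᶜ x = x - E.proj s x := by
  have h := E.proj_union hs hs.compl disjoint_compl_right x
  rw [Set.union_compl_self, E.proj_univ_apply] at h
  rw [eq_sub_iff_add_eq, add_comm, ← h]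

theorem scalarMeasure_univ (x : H) : E.scalarMeasure x Set.univ = ENNReal.ofReal (‖x‖ ^ 2) := by
  rw [E.scalarMeasure_apply x MeasurableSet.univ, E.proj_univ_apply]

instance isFiniteMeasure_scalarMeasure (x : H) : IsFiniteMeasure (E.scalarMeasure x) :=
  ⟨by rw [E.scalarMeasure_univ]; exact ENNReal.ofReal_lt_top⟩

theorem scalarMeasure_real (x : H) {s : Set X} (hs : MeasurableSet s) :
    (E.scalarMeasure x).real s = ‖E.proj s x‖ ^ 2 := by
  rw [Measure.real, E.scalarMeasure_apply x hs, ENNReal.toReal_ofReal (by positivity)]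

theorem norm_proj_le {s : Set X} (hs : MeasurableSet s) (x : H) : ‖E.proj s x‖ ^ 2 ≤ ‖x‖ ^ 2 := by
  have h := measureReal_mono (μ := E.scalarMeasure x) (Set.subset_univ s)
  rwa [E.scalarMeasure_real x hs, E.scalarMeasure_real x MeasurableSet.univ,
    E.proj_univ_apply] at h

theorem proj_proj_of_disjoint {s t : Set X} (hs : MeasurableSet s) (ht : MeasurableSet t)
    (h : Disjoint s t) (x : H) : E.proj s (E.proj t x) = 0 := by
  have h1 := measureReal_union (μ := E.scalarMeasure (E.proj t x)) h ht
  rw [E.scalarMeasure_real _ hs, E.scalarMeasure_real _ ht, E.scalarMeasure_real _ (hs.union ht),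
    E.proj_proj_self ht] at h1
  have h2 := E.norm_proj_le (hs.union ht) (E.proj t x)
  rw [← norm_eq_zero, ← sq_eq_zero_iff]
  nlinarith [sq_nonneg ‖E.proj s (E.proj t x)‖]

theorem proj_proj {s t : Set X} (hs : MeasurableSet s) (ht : MeasurableSet t) (x : H) :
    E.proj s (E.proj t x) = E.proj (s ∩ t) x := by
  have h1 : E.proj t x = E.proj (t ∩ s) x + E.proj (t \ s) x := by
    rw [← E.proj_union (ht.inter hs) (ht.diff hs) (Set.disjoint_sdiff_inter.symm),
      Set.inter_union_sdiff]
  have h2 : E.proj s (E.proj (t ∩ s) x) = E.proj (t ∩ s) x := by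
    have h3 := E.proj_compl hs (E.proj (t ∩ s) x)
    rw [E.proj_proj_of_disjoint hs.compl (ht.inter hs)
      (Set.disjoint_left.mpr fun a ha ha' => ha ha'.2)] at h3
    exact (sub_eq_zero.mp h3.symm).symm
  rw [h1, map_add, h2, E.proj_proj_of_disjoint hs (ht.diff hs) Set.disjoint_sdiff_right, add_zero,
    Set.inter_comm]

theorem scalarMeasure_proj {t : Set X} (ht : MeasurableSet t) (x : H) :
    E.scalarMeasure (E.proj t x) = (E.scalarMeasure x).restrict t := by
  ext s hs
  rw [Measure.restrict_apply hs, E.scalarMeasure_apply _ hs, E.scalarMeasure_apply _ (hs.inter ht),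
    E.proj_proj hs ht]

theorem norm_sq_proj_add {s : Set X} (hs : MeasurableSet s) (x y : H) :
    ‖E.proj s (x + y)‖ ^ 2 =
      ‖E.proj s x‖ ^ 2 + ‖E.proj s y‖ ^ 2 + 2 * (⟪E.proj s x, y⟫_ℂ).re := by
  rw [map_add, norm_add_sq (𝕜 := ℂ), E.inner_proj_proj hs]
  simp only [RCLike.re_eq_complex_re]
  ring

theorem norm_sq_proj_sub {s : Set X} (hs : MeasurableSet s) (x y : H) :
    ‖E.proj s (x - y)‖ ^ 2 =
      ‖E.proj s x‖ ^ 2 + ‖E.proj s y‖ ^ 2 - 2 * (⟪E.proj s x, y⟫_ℂ).re := by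
  rw [map_sub, norm_sub_sq (𝕜 := ℂ), E.inner_proj_proj hs]
  simp only [RCLike.re_eq_complex_re]
  ring

/-- Two spectral measures with the same quadratic forms coincide. -/
theorem ext_of_scalarMeasure {E F : SpectralMeasure X H}
    (h : ∀ x, E.scalarMeasure x = F.scalarMeasure x) : E = F := by
  ext s : 2
  by_cases hs : MeasurableSet s
  · have h1 : ∀ x, ⟪E.proj s x, x⟫_ℂ = ⟪F.proj s x, x⟫_ℂ := fun x => by
      rw [E.inner_proj_comm hs, F.inner_proj_comm hs, E.inner_proj_self hs, F.inner_proj_self hs,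
        ← E.scalarMeasure_real x hs, ← F.scalarMeasure_real x hs, h x]
    have h2 := (ext_inner_map (E.proj s : H →ₗ[ℂ] H) (F.proj s : H →ₗ[ℂ] H)).mp h1
    exact ContinuousLinearMap.coe_injective h2
  · rw [E.proj_of_not_measurableSet s hs, F.proj_of_not_measurableSet s hs]

/-- Strong convergence `E(sₙ) x → x` along an increasing exhaustion. -/
theorem tendsto_proj {s : ℕ → Set X} (hs : ∀ n, MeasurableSet (s n)) (hm : Monotone s)
    (hu : ⋃ n, s n = Set.univ) (x : H) : Tendsto (fun n => E.proj (s n) x) atTop (𝓝 x) := by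
  have h1 : Tendsto (fun n => (E.scalarMeasure x).real (s n)ᶜ) atTop (𝓝 0) := by
    have h2 := tendsto_measure_iInter_atTop (μ := E.scalarMeasure x) (s := fun n => (s n)ᶜ)
      (fun n => (hs n).compl.nullMeasurableSet)
      (fun m n hmn => Set.compl_subset_compl.mpr (hm hmn)) ⟨0, measure_ne_top _ _⟩
    rw [← Set.compl_iUnion, hu, Set.compl_univ, measure_empty] at h2
    exact (ENNReal.tendsto_toReal ENNReal.zero_ne_top).comp h2
  rw [tendsto_iff_norm_sub_tendsto_zero]
  have h3 : ∀ n, ‖E.proj (s n) x - x‖ = √((E.scalarMeasure x).real (s n)ᶜ) := fun n => by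
    rw [E.scalarMeasure_real x (hs n).compl, E.proj_compl (hs n), Real.sqrt_sq (norm_nonneg _),
      norm_sub_rev]
  simp only [h3]
  simpa using h1.sqrt

/-- The image of a spectral measure under a measurable map. -/
def map {Y : Type*} [MeasurableSpace Y] (g : X → Y) (hg : Measurable g) : SpectralMeasure Y H where
  proj s := open scoped Classical in if MeasurableSet s then E.proj (g ⁻¹' s) else 0
  proj_of_not_measurableSet s hs := if_neg hs
  isStarProjection_proj s hs := by
    rw [if_pos hs]
    exact E.isStarProjection_proj _ (hg hs)
  proj_univ := by
    rw [if_pos MeasurableSet.univ, Set.preimage_univ, E.proj_univ]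
  hasSum_proj s hs hd x := by
    rw [if_pos (MeasurableSet.iUnion hs), Set.preimage_iUnion]
    simp only [if_pos (hs _)]
    exact E.hasSum_proj _ (fun i => hg (hs i)) (fun i j hij => (hd hij).preimage g) x

theorem map_proj {Y : Type*} [MeasurableSpace Y] {g : X → Y} (hg : Measurable g) {s : Set Y}
    (hs : MeasurableSet s) : (E.map g hg).proj s = E.proj (g ⁻¹' s) :=
  if_pos hs

theorem scalarMeasure_map {Y : Type*} [MeasurableSpace Y] {g : X → Y} (hg : Measurable g) (x : H) :
    (E.map g hg).scalarMeasure x = (E.scalarMeasure x).map g := by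
  ext s hs
  rw [Measure.map_apply hg hs, scalarMeasure_apply _ x hs, E.scalarMeasure_apply x (hg hs),
    E.map_proj hg hs]

theorem IsIntegral.of_comp {Y : Type*} [MeasurableSpace Y] {g : X → Y} (hg : Measurable g)
    {f : Y → ℝ} (hf : Measurable f) {A : H →ₗ.[ℂ] H} (h : E.IsIntegral (f ∘ g) A) :
    (E.map g hg).IsIntegral f A where
  mem_domain_iff x := by
    rw [h.mem_domain_iff, E.scalarMeasure_map hg,
      memLp_map_measure_iff hf.aestronglyMeasurable hg.aemeasurable]
  inner_apply x := by
    rw [h.inner_apply, E.scalarMeasure_map hg,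
      integral_map hg.aemeasurable hf.aestronglyMeasurable]
    rfl

/-! ### Integrals of nonnegative functions -/

namespace IsIntegral

variable {E} {f : X → ℝ} {A : H →ₗ.[ℂ] H}

theorem memLp (h : E.IsIntegral f A) {x y : H} (hxy : (x, y) ∈ A.graph) :
    MemLp f 2 (E.scalarMeasure x) :=
  (h.mem_domain_iff x).mp (LinearPMap.mem_domain_of_mem_graph hxy)

theorem exists_mem_graph (h : E.IsIntegral f A) {x : H} (hx : MemLp f 2 (E.scalarMeasure x)) :
    ∃ y, (x, y) ∈ A.graph :=
  LinearPMap.mem_domain_iff.mp ((h.mem_domain_iff x).mpr hx)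

theorem inner_eq (h : E.IsIntegral f A) {x y : H} (hxy : (x, y) ∈ A.graph) :
    ⟪x, y⟫_ℂ = ((∫ t, f t ∂(E.scalarMeasure x) : ℝ) : ℂ) := by
  obtain ⟨u, hu, hy⟩ := A.mem_graph_iff.mp hxy
  obtain rfl : (u : H) = x := hu
  obtain rfl : A u = y := hy
  exact h.inner_apply u

theorem of_graph (h₁ : ∀ x, (∃ y, (x, y) ∈ A.graph) ↔ MemLp f 2 (E.scalarMeasure x))
    (h₂ : ∀ x y, (x, y) ∈ A.graph → ⟪x, y⟫_ℂ = ((∫ t, f t ∂(E.scalarMeasure x) : ℝ) : ℂ)) :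
    E.IsIntegral f A where
  mem_domain_iff x := by rw [LinearPMap.mem_domain_iff, h₁]
  inner_apply x := h₂ _ _ (A.mem_graph x)

theorem symmetric (h : E.IsIntegral f A) {x y z w : H} (hxy : (x, y) ∈ A.graph)
    (hzw : (z, w) ∈ A.graph) : ⟪y, z⟫_ℂ = ⟪x, w⟫_ℂ := by
  have him : ∀ a b, (a, b) ∈ A.graph → (⟪a, b⟫_ℂ).im = 0 := fun a b hab => by
    rw [h.inner_eq hab, Complex.ofReal_im]
  have h1 := him _ _ (A.graph.add_mem hxy hzw)
  have h2 := him _ _ (A.graph.add_mem hxy (A.graph.smul_mem Complex.I hzw))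
  have h3 := him _ _ hxy
  have h4 := him _ _ hzw
  rw [inner_add_left, inner_add_right, inner_add_right] at h1
  simp only [Prod.smul_fst, Prod.smul_snd] at h2
  rw [inner_add_left, inner_add_right, inner_add_right, inner_smul_left, inner_smul_right,
    inner_smul_left, inner_smul_right] at h2
  simp only [Complex.add_im, Complex.mul_im, Complex.mul_re, Complex.conj_I, Complex.neg_re,
    Complex.neg_im, Complex.I_re, Complex.I_im] at h1 h2
  rw [← inner_conj_symm y z]
  apply Complex.ext
  · rw [Complex.conj_re]
    linarith
  · rw [Complex.conj_im]
    linarith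

theorem memLp_proj (h : E.IsIntegral f A) {x y : H} (hxy : (x, y) ∈ A.graph) {s : Set X}
    (hs : MeasurableSet s) : MemLp f 2 (E.scalarMeasure (E.proj s x)) := by
  rw [E.scalarMeasure_proj hs]
  exact (h.memLp hxy).restrict s

theorem memLp_proj_of_bounded (hf : Measurable f) (x : H) {s : Set X} (hs : MeasurableSet s)
    {c : ℝ} (hc : ∀ t ∈ s, |f t| ≤ c) : MemLp f 2 (E.scalarMeasure (E.proj s x)) := by
  rw [E.scalarMeasure_proj hs]
  exact MemLp.of_bound hf.aestronglyMeasurable c (ae_restrict_of_forall_mem hs hc)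

theorem measurableSet_abs_le (hf : Measurable f) (c : ℝ) : MeasurableSet {t | |f t| ≤ c} :=
  measurableSet_le hf.abs measurable_const

theorem dense_domain (h : E.IsIntegral f A) (hf : Measurable f) : Dense (A.domain : Set H) := by
  intro x
  refine mem_closure_of_tendsto (E.tendsto_proj (s := fun n : ℕ => {t | |f t| ≤ n})
    (fun n => measurableSet_abs_le hf n) (fun m n hmn t ht => le_trans (Set.mem_ofPred_eq.mp ht) (Nat.cast_le.mpr hmn))
    (iUnion_abs_le f) x) (Eventually.of_forall fun n => ?_)
  exact (h.mem_domain_iff _).mpr (memLp_proj_of_bounded hf x (measurableSet_abs_le hf n)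
    fun t ht => ht)

theorem scalarMeasure_add_of_proj (E : SpectralMeasure X H) {s : Set X} (hs : MeasurableSet s)
    (x y : H) : E.scalarMeasure (E.proj s x + E.proj sᶜ y) =
      E.scalarMeasure (E.proj s x) + E.scalarMeasure (E.proj sᶜ y) := by
  ext t ht
  rw [Measure.add_apply, E.scalarMeasure_apply _ ht, E.scalarMeasure_apply _ ht,
    E.scalarMeasure_apply _ ht, ← ENNReal.ofReal_add (by positivity) (by positivity),
    E.norm_sq_proj_add ht]
  have h1 : ⟪E.proj t (E.proj s x), E.proj sᶜ y⟫_ℂ = 0 := by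
    rw [E.proj_proj ht hs, Set.inter_comm, ← E.proj_proj hs ht, E.inner_proj_comm hs,
      E.proj_proj_of_disjoint hs hs.compl disjoint_compl_right, inner_zero_right]
  rw [h1, Complex.zero_re, mul_zero, add_zero]

/-- The quadratic form of `A` has no cross terms between the ranges of `E(s)` and `E(sᶜ)`. -/
theorem inner_eq_zero_of_compl (h : E.IsIntegral f A) {s : Set X}
    (hs : MeasurableSet s) {x y z w : H} (hxy : (E.proj s x, y) ∈ A.graph)
    (hzw : (E.proj sᶜ z, w) ∈ A.graph) : ⟪E.proj s x, w⟫_ℂ = 0 := by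
  have key : ∀ {x y z w : H}, (E.proj s x, y) ∈ A.graph → (E.proj sᶜ z, w) ∈ A.graph →
      (⟪E.proj s x, w⟫_ℂ).re = 0 := by
    intro x y z w hxy hzw
    have i1 := ((h.memLp hxy).integrable (by norm_num))
    have i2 := ((h.memLp hzw).integrable (by norm_num))
    have h1 := h.inner_eq (A.graph.add_mem hxy hzw)
    simp only at h1
    rw [scalarMeasure_add_of_proj E hs, integral_add_measure i1 i2, inner_add_left, inner_add_right,
      inner_add_right, h.inner_eq hxy, h.inner_eq hzw, ← h.symmetric hzw hxy] at h1
    have h2 := congrArg Complex.re h1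
    have h3 : (⟪w, E.proj s x⟫_ℂ).re = (⟪E.proj s x, w⟫_ℂ).re := by
      rw [← inner_conj_symm, Complex.conj_re]
    simp only [Complex.add_re, Complex.ofReal_re, h3] at h2
    linarith
  apply Complex.ext
  · exact key hxy hzw
  · have h1 := A.graph.smul_mem Complex.I hzw
    rw [Prod.smul_mk, ← map_smul] at h1
    have h2 := key hxy h1
    rw [inner_smul_right] at h2
    simpa using h2

/-- `E(s) A ⊆ A E(s)`. -/
theorem intertwines_proj (h : E.IsIntegral f A) (hf : Measurable f) {s : Set X}
    (hs : MeasurableSet s) : Intertwines (E.proj s) A := by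
  have key : ∀ {s : Set X}, MeasurableSet s → ∀ {z w : H}, (E.proj sᶜ z, w) ∈ A.graph →
      E.proj s w = 0 := by
    intro s hs z w hzw
    refine (h.dense_domain hf).eq_zero_of_inner_right ℂ fun v hv => ?_
    obtain ⟨u, hu⟩ := LinearPMap.mem_domain_iff.mp hv
    obtain ⟨y, hy⟩ := h.exists_mem_graph (h.memLp_proj hu hs)
    rw [← E.inner_proj_comm hs, h.inner_eq_zero_of_compl hs hy hzw]
  intro x y hxy
  obtain ⟨a, ha⟩ := h.exists_mem_graph (h.memLp_proj hxy hs)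
  obtain ⟨b, hb⟩ := h.exists_mem_graph (h.memLp_proj hxy hs.compl)
  have hab : a + b = y := by
    refine eq_of_mem_graph ?_ hxy
    have h1 := A.graph.add_mem ha hb
    rwa [Prod.mk_add_mk, E.proj_compl hs, add_sub_cancel] at h1
  have h1 : E.proj s b = 0 := key hs hb
  have h2 : E.proj sᶜ a = 0 := key hs.compl (by rwa [compl_compl])
  rw [E.proj_compl hs, sub_eq_zero] at h2
  rwa [← hab, map_add, h1, add_zero, ← h2]

/-- `⟨E(s) x, A x⟩ = ∫_s f dμ_x`. -/
theorem inner_proj_eq (h : E.IsIntegral f A) (hf : Measurable f) {x y : H}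
    (hxy : (x, y) ∈ A.graph) {s : Set X} (hs : MeasurableSet s) :
    ⟪E.proj s x, y⟫_ℂ = ((∫ t in s, f t ∂(E.scalarMeasure x) : ℝ) : ℂ) := by
  rw [← E.inner_proj_proj hs, h.inner_eq (h.intertwines_proj hf hs _ _ hxy),
    E.scalarMeasure_proj hs]

variable (hf0 : ∀ t, 0 ≤ f t)
include hf0

theorem ofReal_inner_eq (h : E.IsIntegral f A) {x y : H} (hxy : (x, y) ∈ A.graph) :
    ENNReal.ofReal (⟪x, y⟫_ℂ).re = ∫⁻ t, ENNReal.ofReal (f t) ∂(E.scalarMeasure x) := by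
  rw [h.inner_eq hxy, Complex.ofReal_re,
    ofReal_integral_eq_lintegral_ofReal ((h.memLp hxy).integrable (by norm_num))
      (Eventually.of_forall hf0)]

theorem scalarMeasure_add (h : E.IsIntegral f A) (hf : Measurable f) {x y : H}
    (hxy : (x, y) ∈ A.graph) : E.scalarMeasure (x + y) =
      E.scalarMeasure x + E.scalarMeasure y +
        (E.scalarMeasure x).withDensity (fun t => 2 * ENNReal.ofReal (f t)) := by
  ext s hs
  have h1 : ENNReal.ofReal (⟪E.proj s x, y⟫_ℂ).re =
      ∫⁻ t in s, ENNReal.ofReal (f t) ∂(E.scalarMeasure x) := by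
    rw [h.inner_proj_eq hf hxy hs, Complex.ofReal_re,
      ofReal_integral_eq_lintegral_ofReal ((h.memLp hxy).integrable (by norm_num)).integrableOn
        (Eventually.of_forall hf0)]
  have h2 : 0 ≤ (⟪E.proj s x, y⟫_ℂ).re := by
    rw [h.inner_proj_eq hf hxy hs, Complex.ofReal_re]
    exact integral_nonneg hf0
  rw [Measure.add_apply, Measure.add_apply, withDensity_apply _ hs,
    lintegral_const_mul _ hf.ennreal_ofReal, ← h1, E.scalarMeasure_apply _ hs,
    E.scalarMeasure_apply _ hs, E.scalarMeasure_apply _ hs, E.norm_sq_proj_add hs,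
    ENNReal.ofReal_add (by positivity) (by positivity),
    ENNReal.ofReal_add (by positivity) (by positivity), ENNReal.ofReal_mul (by norm_num),
    ENNReal.ofReal_ofNat]

theorem norm_sq_of_mem_graph (h : E.IsIntegral f A) (hf : Measurable f) {x y z : H}
    (hxy : (x, y) ∈ A.graph) (hyz : (y, z) ∈ A.graph) :
    ENNReal.ofReal (‖y‖ ^ 2) = ∫⁻ t, ENNReal.ofReal (f t) ^ 2 ∂(E.scalarMeasure x) := by
  have hm : Measurable fun t => ENNReal.ofReal (f t) := hf.ennreal_ofReal
  have h1 := h.ofReal_inner_eq hf0 (A.graph.add_mem hxy hyz)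
  have hx0 : 0 ≤ (⟪x, y⟫_ℂ).re := by
    rw [h.inner_eq hxy, Complex.ofReal_re]
    exact integral_nonneg hf0
  have hy0 : 0 ≤ (⟪y, z⟫_ℂ).re := by
    rw [h.inner_eq hyz, Complex.ofReal_re]
    exact integral_nonneg hf0
  simp only at h1
  rw [h.scalarMeasure_add hf0 hf hxy, lintegral_add_measure, lintegral_add_measure,
    ← h.ofReal_inner_eq hf0 hxy, ← h.ofReal_inner_eq hf0 hyz, inner_add_left, inner_add_right,
    inner_add_right, ← h.symmetric hxy hyz, Complex.add_re, Complex.add_re, Complex.add_re,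
    re_inner_self, lintegral_withDensity_eq_lintegral_mul _ (hm.const_mul 2) hm] at h1
  have h2 : (⟪x, y⟫_ℂ).re + ‖y‖ ^ 2 + (‖y‖ ^ 2 + (⟪y, z⟫_ℂ).re) =
      (⟪x, y⟫_ℂ).re + (⟪y, z⟫_ℂ).re + 2 * ‖y‖ ^ 2 := by ring
  rw [h2, ENNReal.ofReal_add (by positivity) (by positivity), ENNReal.ofReal_add hx0 hy0,
    ENNReal.add_right_inj (by simp), ENNReal.ofReal_mul (by norm_num), ENNReal.ofReal_ofNat] at h1
  simp only [Pi.mul_apply, mul_assoc] at h1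
  rw [lintegral_const_mul _ (by fun_prop)] at h1
  rw [(ENNReal.mul_right_inj (by norm_num) (by norm_num)).mp h1]
  simp only [sq]

/-- `μ_{A x} = f² μ_x`. -/
theorem scalarMeasure_apply_eq (h : E.IsIntegral f A) (hf : Measurable f) {x y : H}
    (hxy : (x, y) ∈ A.graph) : E.scalarMeasure y =
      (E.scalarMeasure x).withDensity (fun t => ENNReal.ofReal (f t) ^ 2) := by
  refine (Measure.ext_iff_of_iUnion_eq_univ (iUnion_abs_le f)).mpr fun n => ?_
  ext s hs
  have hn := measurableSet_abs_le hf (n : ℝ)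
  have hsn := hs.inter hn
  obtain ⟨z, hz⟩ := h.exists_mem_graph (memLp_proj_of_bounded hf y hsn (c := n) fun t ht => ht.2)
  rw [Measure.restrict_apply hs, Measure.restrict_apply hs, E.scalarMeasure_apply y hsn,
    withDensity_apply _ hsn,
    h.norm_sq_of_mem_graph hf0 hf (h.intertwines_proj hf hsn _ _ hxy) hz, E.scalarMeasure_proj hsn]

/-- `μ_{(I + A) x} = (1 + f)² μ_x`. -/
theorem scalarMeasure_add_apply_eq (h : E.IsIntegral f A) (hf : Measurable f) {x y : H}
    (hxy : (x, y) ∈ A.graph) : E.scalarMeasure (x + y) =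
      (E.scalarMeasure x).withDensity (fun t => ENNReal.ofReal (1 + f t) ^ 2) := by
  have hm : Measurable fun t => ENNReal.ofReal (f t) := hf.ennreal_ofReal
  rw [h.scalarMeasure_add hf0 hf hxy, h.scalarMeasure_apply_eq hf0 hf hxy]
  nth_rewrite 1 [← withDensity_one (μ := E.scalarMeasure x)]
  rw [← withDensity_add_left measurable_one, ← withDensity_add_right _ (hm.const_mul 2)]
  congr 1
  ext t
  simp only [Pi.add_apply, Pi.one_apply]
  rw [ENNReal.ofReal_add zero_le_one (hf0 t), ENNReal.ofReal_one]
  ring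

end IsIntegral

end SpectralMeasure

end Spectral

section Moments

/-! ### Powers and resolvents in terms of the spectral measure -/

theorem memLp_withDensity_sq_iff {X : Type*} [MeasurableSpace X] {μ : Measure X} {f g : X → ℝ}
    (hf : Measurable f) (hf0 : ∀ t, 0 ≤ f t) (hg : Measurable g) :
    MemLp g 2 (μ.withDensity fun t => ENNReal.ofReal (f t) ^ 2) ↔
      MemLp (fun t => f t * g t) 2 μ := by
  rw [memLp_two_iff_integrable_sq hg.aestronglyMeasurable,
    memLp_two_iff_integrable_sq (f := fun t => f t * g t) (hf.mul hg).aestronglyMeasurable,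
    integrable_withDensity_iff_integrable_smul' (hf.ennreal_ofReal.pow_const 2)
      (Eventually.of_forall fun t => by simp)]
  simp only [ENNReal.toReal_pow, ENNReal.toReal_ofReal (hf0 _), smul_eq_mul, mul_pow]

theorem integral_withDensity_sq {X : Type*} [MeasurableSpace X] {μ : Measure X} {f : X → ℝ}
    (hf : Measurable f) (hf0 : ∀ t, 0 ≤ f t) (g : X → ℝ) :
    ∫ t, g t ∂(μ.withDensity fun t => ENNReal.ofReal (f t) ^ 2) = ∫ t, f t ^ 2 * g t ∂μ := by
  rw [integral_withDensity_eq_integral_toReal_smul (hf.ennreal_ofReal.pow_const 2)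
    (Eventually.of_forall fun t => by simp)]
  simp only [ENNReal.toReal_pow, ENNReal.toReal_ofReal (hf0 _), smul_eq_mul]

/-- Finite measures on `[0, ∞)` are determined by the integrals of the powers of `(1 + t)⁻¹`, by
the Stone-Weierstrass theorem. -/
theorem measure_ext_of_integral_inv_pow {μ ν : Measure ℝ≥0} [IsFiniteMeasure μ]
    [IsFiniteMeasure ν]
    (h : ∀ n : ℕ, ∫ t, ((1 + (t : ℝ))⁻¹) ^ n ∂μ = ∫ t, ((1 + (t : ℝ))⁻¹) ^ n ∂ν) : μ = ν := by
  let g : BoundedContinuousFunction ℝ≥0 ℝ := BoundedContinuousFunction.ofNormedAddCommGroup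
    (fun t => (1 + (t : ℝ))⁻¹)
    ((continuous_const.add NNReal.continuous_coe).inv₀ fun t => (add_pos_of_pos_of_nonneg one_pos t.2).ne') 1 (fun t => by
      rw [Real.norm_of_nonneg (by positivity)]
      exact inv_le_one_of_one_le₀ (by simp))
  let A : StarSubalgebra ℝ (BoundedContinuousFunction ℝ≥0 ℝ) :=
    { toSubalgebra := (Polynomial.aeval g).range
      star_mem' := fun {a} ha => by
        have : star a = a := by ext t; rfl
        rwa [this] }
  refine ext_of_forall_mem_subalgebra_integral_eq_of_polish (A := A) ?_ ?_
  · intro s t hst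
    refine ⟨_, ⟨_, ⟨g, ⟨Polynomial.X, by simp⟩, rfl⟩, rfl⟩, ?_⟩
    intro he
    apply hst
    have he' : (1 + (s : ℝ))⁻¹ = (1 + (t : ℝ))⁻¹ := he
    exact_mod_cast add_left_cancel (inv_injective he')
  · rintro _ ⟨p, rfl⟩
    have hint : ∀ (ρ : Measure ℝ≥0) [IsFiniteMeasure ρ],
        ∫ t, (Polynomial.aeval g p) t ∂ρ =
          ∑ i ∈ p.support, p.coeff i * ∫ t, ((1 + (t : ℝ))⁻¹) ^ i ∂ρ := by
      intro ρ _
      simp only [← integral_const_mul]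
      rw [← integral_finsetSum]
      · refine integral_congr_ae (Eventually.of_forall fun t => ?_)
        simp only [Polynomial.aeval_def, Polynomial.eval₂_eq_sum,
          Polynomial.sum_def, BoundedContinuousFunction.coe_sum, Finset.sum_apply]
        refine Finset.sum_congr rfl fun i _ => ?_
        rfl
      · intro i _
        exact ((g ^ i).integrable ρ).const_mul _
    have h1 := hint μ
    have h2 := hint ν
    simp only [h] at h1
    exact h1.trans h2.symm

namespace SpectralMeasure

namespace IsIntegral

variable {X : Type*} [MeasurableSpace X] {H : Type*} [NormedAddCommGroup H]
    [InnerProductSpace ℂ H] [CompleteSpace H] {E : SpectralMeasure X H}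
    {f : X → ℝ} {T : H →ₗ.[ℂ] H} {R : H →L[ℂ] H}

/-- The operator `∫ f dE` is determined by `E` and `f`. -/
theorem unique (hf : Measurable f) {A B : H →ₗ.[ℂ] H} (hA : E.IsIntegral f A)
    (hB : E.IsIntegral f B) : A = B := by
  have hex : ∀ {x y}, (x, y) ∈ A.graph → ∃ z, (x, z) ∈ B.graph := fun hxy =>
    hB.exists_mem_graph (hA.memLp hxy)
  have hex' : ∀ {x y}, (x, y) ∈ B.graph → ∃ z, (x, z) ∈ A.graph := fun hxy =>
    hA.exists_mem_graph (hB.memLp hxy)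
  -- polarization of the quadratic form of the symmetric operator `A - B`, which vanishes
  have key : ∀ {x y z a b c}, (x, y) ∈ A.graph → (x, z) ∈ B.graph → (a, b) ∈ A.graph →
      (a, c) ∈ B.graph → (⟪a, y - z⟫_ℂ).re = 0 := by
    intro x y z a b c hxy hxz hab hac
    have e1 := (hA.inner_eq hxy).trans (hB.inner_eq hxz).symm
    have e2 := (hA.inner_eq hab).trans (hB.inner_eq hac).symm
    have e3 := (hA.inner_eq (A.graph.add_mem hxy hab)).trans
      (hB.inner_eq (B.graph.add_mem hxz hac)).symm
    simp only at e3
    rw [inner_add_left, inner_add_right, inner_add_right, inner_add_left, inner_add_right,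
      inner_add_right, e1, e2, ← hA.symmetric hxy hab, ← hB.symmetric hxz hac,
      ← inner_conj_symm y, ← inner_conj_symm z] at e3
    have e4 := congrArg Complex.re e3
    simp only [Complex.add_re, Complex.conj_re] at e4
    rw [inner_sub_right, Complex.sub_re]
    linarith
  have heq : ∀ {x y z}, (x, y) ∈ A.graph → (x, z) ∈ B.graph → y = z := by
    intro x y z hxy hxz
    rw [← sub_eq_zero]
    refine (hA.dense_domain hf).eq_zero_of_inner_right ℂ fun v hv => ?_
    obtain ⟨b, hb⟩ := LinearPMap.mem_domain_iff.mp hv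
    obtain ⟨c, hc⟩ := hex hb
    apply Complex.ext
    · exact key hxy hxz hb hc
    · have h1 := key hxy hxz (c := Complex.I • c) (A.graph.smul_mem Complex.I hb)
        (B.graph.smul_mem Complex.I hc)
      rw [inner_smul_left] at h1
      simpa using h1
  refine ext_graph fun x y => ⟨fun hxy => ?_, fun hxy => ?_⟩
  · obtain ⟨z, hz⟩ := hex hxy
    rwa [heq hxy hz]
  · obtain ⟨z, hz⟩ := hex' hxy
    rwa [← heq hz hxy]

/-- If `T = ∫ f dE` with `f ≥ 0`, then `Tⁿ = ∫ fⁿ dE`. Both the domain and the quadratic form are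
found by induction, from `μ_{T x} = f² μ_x` and `⟨x, Tⁿ⁺² x⟩ = ⟨T x, Tⁿ T x⟩`. -/
theorem pow (hT : E.IsIntegral f T) (hf : Measurable f) (hf0 : ∀ t, 0 ≤ f t) (n : ℕ) :
    E.IsIntegral (fun t => f t ^ n) (UnboundedOp.pow T n) := by
  refine of_graph (fun x => ?_) ?_
  · induction n generalizing x with
    | zero =>
      simp only [pow_zero]
      exact ⟨fun _ => memLp_const 1, fun _ => ⟨x, mem_graph_pow_zero.mpr rfl⟩⟩
    | succ n ih =>
      have hmem : ∀ {y}, (x, y) ∈ T.graph →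
          (MemLp (fun t => f t ^ n) 2 (E.scalarMeasure y) ↔
            MemLp (fun t => f t ^ (n + 1)) 2 (E.scalarMeasure x)) := by
        intro y hxy
        rw [hT.scalarMeasure_apply_eq hf0 hf hxy, memLp_withDensity_sq_iff hf hf0 (hf.pow_const n)]
        simp only [pow_succ']
      constructor
      · rintro ⟨z, hz⟩
        obtain ⟨y, hxy, hyz⟩ := mem_graph_pow_succ.mp hz
        exact (hmem hxy).mp ((ih y).mp ⟨z, hyz⟩)
      · intro h
        have h1 : MemLp f 2 (E.scalarMeasure x) := by
          refine ((memLp_const (1 : ℝ)).add h).mono' hf.aestronglyMeasurable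
            (Eventually.of_forall fun t => ?_)
          rw [Real.norm_of_nonneg (hf0 t), Pi.add_apply]
          rcases le_total (f t) 1 with h2 | h2
          · have := pow_nonneg (hf0 t) (n + 1)
            linarith
          · have h3 : f t ≤ f t ^ (n + 1) := le_self_pow₀ h2 (Nat.succ_ne_zero n)
            linarith
        obtain ⟨y, hxy⟩ := hT.exists_mem_graph h1
        obtain ⟨z, hz⟩ := (ih y).mpr ((hmem hxy).mpr h)
        exact ⟨z, mem_graph_pow_succ.mpr ⟨y, hxy, hz⟩⟩
  · induction n using Nat.twoStepInduction with
    | zero =>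
      intro x y hxy
      rw [mem_graph_pow_zero] at hxy
      simp only [pow_zero, integral_const, smul_eq_mul, mul_one]
      rw [E.scalarMeasure_real x MeasurableSet.univ, E.proj_univ_apply, ← hxy,
        inner_self_eq_norm_sq_to_K]
      norm_cast
    | one =>
      intro x y hxy
      simp only [pow_one]
      exact hT.inner_eq (mem_graph_pow_one.mp hxy)
    | more n ih _ =>
      intro x z hxz
      obtain ⟨y, hxy, hyz⟩ := mem_graph_pow_succ.mp hxz
      obtain ⟨v, hyv, hvz⟩ := mem_graph_pow_succ'.mp hyz
      rw [← hT.symmetric hxy hvz, ih y v hyv, hT.scalarMeasure_apply_eq hf0 hf hxy,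
        integral_withDensity_sq hf hf0]
      simp only [← pow_add, add_comm 2 n]

/-- The moments `∫ (1 + f)⁻ⁿ dμ_x = ⟨x, (I + T)⁻ⁿ x⟩` of the resolvent of `T = ∫ f dE`, from
`μ_x = (1 + f)² μ_y` for `y = (I + T)⁻¹ x`. -/
theorem integral_inv_pow (hT : E.IsIntegral f T) (hf : Measurable f) (hf0 : ∀ t, 0 ≤ f t)
    (hR : IsResolvent R T) (n : ℕ) (x : H) :
    ∫ t, ((1 + f t)⁻¹) ^ n ∂(E.scalarMeasure x) = (⟪x, (R ^ n) x⟫_ℂ).re := by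
  have hstep : ∀ (x : H) (g : X → ℝ), ∫ t, g t ∂(E.scalarMeasure x) =
      ∫ t, (1 + f t) ^ 2 * g t ∂(E.scalarMeasure (R x)) := by
    intro x g
    have h1 := hT.scalarMeasure_add_apply_eq hf0 hf (hR.apply_mem_graph x)
    rw [add_sub_cancel] at h1
    rw [h1, integral_withDensity_sq (hf.const_add 1) fun t => add_nonneg zero_le_one (hf0 t)]
  have hne : ∀ t, 1 + f t ≠ 0 := fun t => by linarith [hf0 t]
  induction n using Nat.twoStepInduction generalizing x with
  | zero =>
    simp only [pow_zero, integral_const, smul_eq_mul, mul_one, one_apply_eq_self]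
    rw [E.scalarMeasure_real x MeasurableSet.univ, E.proj_univ_apply, re_inner_self]
  | one =>
    have hx := hR.apply_mem_graph x
    have h1 : ∀ t, (1 + f t) ^ 2 * ((1 + f t)⁻¹) ^ 1 = 1 + f t := fun t => by
      field_simp [hne t]
    rw [hstep]
    simp only [h1]
    rw [integral_add (integrable_const 1) ((hT.memLp hx).integrable (by norm_num)), pow_one,
      ← hR.inner_comm]
    rw [show ⟪R x, x⟫_ℂ = ⟪R x, R x + (x - R x)⟫_ℂ by rw [add_sub_cancel], inner_add_right, hT.inner_eq hx, Complex.add_re, re_inner_self, Complex.ofReal_re]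
    simp only [integral_const, smul_eq_mul, mul_one]
    rw [E.scalarMeasure_real _ MeasurableSet.univ, E.proj_univ_apply]
  | more n ih _ =>
    have h1 : ∀ t, (1 + f t) ^ 2 * ((1 + f t)⁻¹) ^ (n + 2) = ((1 + f t)⁻¹) ^ n := fun t => by
      have := hne t
      rw [pow_add, mul_comm, mul_assoc, ← mul_pow, inv_mul_cancel₀ this, one_pow, mul_one]
    rw [hstep]
    simp only [h1]
    rw [ih, hR.inner_comm, pow_add, pow_two, ← mul_apply_eq_comp, ← mul_apply_eq_comp]
    rw [← mul_assoc, ← (Commute.pow_self R n).eq, mul_assoc]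

theorem integrable_inv_pow (hf : Measurable f) (hf0 : ∀ t, 0 ≤ f t) (μ : Measure X)
    [IsFiniteMeasure μ] (n : ℕ) : Integrable (fun t => ((1 + f t)⁻¹) ^ n) μ := by
  refine Integrable.of_bound (by fun_prop) 1 (Eventually.of_forall fun t => ?_)
  have h1 : 0 ≤ (1 + f t)⁻¹ := inv_nonneg.mpr (add_nonneg zero_le_one (hf0 t))
  rw [Real.norm_of_nonneg (by positivity)]
  exact pow_le_one₀ h1 (inv_le_one_of_one_le₀ (by linarith [hf0 t]))

end IsIntegral

variable {H : Type*} [NormedAddCommGroup H] [InnerProductSpace ℂ H] [CompleteSpace H]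

/-- The spectral measure of a positive selfadjoint operator is unique. -/
theorem eq_of_isIntegral {E F : SpectralMeasure ℝ≥0 H} {T : H →ₗ.[ℂ] H} {R : H →L[ℂ] H}
    (hR : IsResolvent R T) (hE : E.IsIntegral (fun t => (t : ℝ)) T)
    (hF : F.IsIntegral (fun t => (t : ℝ)) T) : E = F := by
  refine ext_of_scalarMeasure fun x => measure_ext_of_integral_inv_pow fun n => ?_
  rw [hE.integral_inv_pow measurable_coe_nnreal_real (fun t => t.2) hR,
    hF.integral_inv_pow measurable_coe_nnreal_real (fun t => t.2) hR]

/-- By polarization, the vanishing of the signed measure `Re (⟨p, E(·) y⟩ + ⟨q, E(·) w⟩)` is an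
equality between two finite measures. -/
theorem forall_inner_proj_iff {X : Type*} [MeasurableSpace X] (E : SpectralMeasure X H)
    (p q y w : H) :
    (∀ s, MeasurableSet s → (⟪p, E.proj s y⟫_ℂ + ⟪q, E.proj s w⟫_ℂ).re = 0) ↔
      E.scalarMeasure (p + y) + E.scalarMeasure (q + w) =
        E.scalarMeasure (p - y) + E.scalarMeasure (q - w) := by
  rw [Measure.ext_iff]
  refine forall₂_congr fun s hs => ?_
  rw [Measure.add_apply, Measure.add_apply, E.scalarMeasure_apply _ hs, E.scalarMeasure_apply _ hs,
    E.scalarMeasure_apply _ hs, E.scalarMeasure_apply _ hs,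
    ← ENNReal.ofReal_add (by positivity) (by positivity),
    ← ENNReal.ofReal_add (by positivity) (by positivity),
    ENNReal.ofReal_eq_ofReal_iff (by positivity) (by positivity), E.norm_sq_proj_add hs,
    E.norm_sq_proj_add hs, E.norm_sq_proj_sub hs, E.norm_sq_proj_sub hs, E.inner_proj_comm hs,
    E.inner_proj_comm hs, Complex.add_re]
  constructor <;> intro h <;> linarith

theorem re_inner_add_sub_re_inner_sub {B : H →L[ℂ] H} (hB : IsSelfAdjoint B) (p y : H) :
    (⟪p + y, B (p + y)⟫_ℂ).re = (⟪p - y, B (p - y)⟫_ℂ).re + 4 * (⟪p, B y⟫_ℂ).re := by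
  have h1 : (⟪y, B p⟫_ℂ).re = (⟪p, B y⟫_ℂ).re := by
    rw [← inner_conj_symm, Complex.conj_re]
    exact congrArg Complex.re (ContinuousLinearMap.isSelfAdjoint_iff_isSymmetric.mp hB p y)
  simp only [map_add, map_sub, inner_add_left, inner_add_right, inner_sub_left, inner_sub_right,
    Complex.add_re, Complex.sub_re, h1]
  ring

/-- If `(I + T)⁻¹` intertwines the closed operator `C`, so does the spectral measure of `T`. -/
theorem intertwines_proj_of_resolvent {E : SpectralMeasure ℝ≥0 H} {T C : H →ₗ.[ℂ] H}
    {R : H →L[ℂ] H} (hC : C.IsClosed) (hR : IsResolvent R T)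
    (hE : E.IsIntegral (fun t => (t : ℝ)) T) (h : Intertwines R C) {s : Set ℝ≥0}
    (hs : MeasurableSet s) : Intertwines (E.proj s) C := by
  intro y w hyw
  refine mem_graph_of_forall_annihilator hC fun p q hpq => ?_
  refine (E.forall_inner_proj_iff p q y w).mpr (measure_ext_of_integral_inv_pow fun n => ?_) s hs
  have hi := fun x => IsIntegral.integrable_inv_pow measurable_coe_nnreal_real (fun t => t.2)
    (E.scalarMeasure x) n
  have h1 := congrArg Complex.re (hpq _ _ (h.pow n _ _ hyw))
  rw [Complex.add_re, Complex.zero_re] at h1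
  have hRn := hR.isSelfAdjoint.pow n
  rw [integral_add_measure (hi _) (hi _), integral_add_measure (hi _) (hi _)]
  simp only [hE.integral_inv_pow measurable_coe_nnreal_real (fun t => t.2) hR]
  rw [re_inner_add_sub_re_inner_sub hRn, re_inner_add_sub_re_inner_sub hRn q]
  linarith

/-- If the spectral measure of `T` intertwines the closed operator `C`, so does `(I + T)⁻¹`. -/
theorem intertwines_resolvent_of_proj {X : Type*} [MeasurableSpace X] {E : SpectralMeasure X H}
    {f : X → ℝ} {T C : H →ₗ.[ℂ] H} {R : H →L[ℂ] H} (hC : C.IsClosed) (hR : IsResolvent R T)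
    (hf : Measurable f) (hf0 : ∀ t, 0 ≤ f t) (hE : E.IsIntegral f T)
    (h : ∀ s, MeasurableSet s → Intertwines (E.proj s) C) : Intertwines R C := by
  intro y w hyw
  refine mem_graph_of_forall_annihilator hC fun p q hpq => ?_
  have h1 := (E.forall_inner_proj_iff p q y w).mp fun s hs => by
    rw [hpq _ _ (h s hs _ _ hyw), Complex.zero_re]
  have hi := fun x => IsIntegral.integrable_inv_pow hf hf0 (E.scalarMeasure x) 1
  have h2 := congrArg (fun μ : Measure X => ∫ t, ((1 + f t)⁻¹) ^ 1 ∂μ) h1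
  beta_reduce at h2
  rw [integral_add_measure (hi _) (hi _), integral_add_measure (hi _) (hi _)] at h2
  simp only [hE.integral_inv_pow hf hf0 hR] at h2
  rw [pow_one] at h2
  rw [re_inner_add_sub_re_inner_sub hR.isSelfAdjoint,
    re_inner_add_sub_re_inner_sub hR.isSelfAdjoint q] at h2
  rw [Complex.add_re]
  linarith

end SpectralMeasure

end Moments

section Existence

/-! ### Projections and strong limits -/

section Projections

variable {H : Type*} [NormedAddCommGroup H] [InnerProductSpace ℂ H] [CompleteSpace H]

omit [CompleteSpace H] in
theorem ext_of_inner {A B : H →L[ℂ] H} (h : ∀ x, ⟪x, A x⟫_ℂ = ⟪x, B x⟫_ℂ) : A = B := by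
  have h1 : ∀ x, ⟪A x, x⟫_ℂ = ⟪B x, x⟫_ℂ := fun x => by
    rw [← inner_conj_symm, h x, inner_conj_symm]
  exact ContinuousLinearMap.coe_injective ((ext_inner_map (A : H →ₗ[ℂ] H) (B : H →ₗ[ℂ] H)).mp h1)

theorem isStarProjection_of_inner {B : H →L[ℂ] H}
    (h : ∀ x, ⟪x, B x⟫_ℂ = ((‖B x‖ ^ 2 : ℝ) : ℂ)) : IsStarProjection B := by
  have h1 : IsSelfAdjoint B := isSelfAdjoint_of_inner_real fun x => by
    rw [h x, Complex.ofReal_im]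
  refine ⟨ext_of_inner fun x => ?_, h1⟩
  rw [h x, mul_apply_eq_comp]
  have h2 := ContinuousLinearMap.isSelfAdjoint_iff_isSymmetric.mp h1 x (B x)
  simp only [ContinuousLinearMap.coe_coe] at h2
  rw [← h2, inner_self_eq_norm_sq_to_K]
  norm_cast

theorem inner_of_isStarProjection {B : H →L[ℂ] H} (hB : IsStarProjection B) (x : H) :
    ⟪x, B x⟫_ℂ = ((‖B x‖ ^ 2 : ℝ) : ℂ) := by
  have h2 := ContinuousLinearMap.isSelfAdjoint_iff_isSymmetric.mp hB.isSelfAdjoint x (B x)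
  have h3 : B (B x) = B x := congrArg (fun T => T x) hB.isIdempotentElem
  simp only [ContinuousLinearMap.coe_coe] at h2
  rw [h3] at h2
  rw [← h2, inner_self_eq_norm_sq_to_K]
  norm_cast

theorem eq_of_norm_sq_eq {A B : H →L[ℂ] H} (hA : IsStarProjection A) (hB : IsStarProjection B)
    (h : ∀ x, ‖A x‖ ^ 2 = ‖B x‖ ^ 2) : A = B :=
  ext_of_inner fun x => by
    rw [inner_of_isStarProjection hA, inner_of_isStarProjection hB, h x]

/-- Projections `Bᵢ` whose quadratic forms are the values of measures on pairwise disjoint sets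
`sᵢ` are mutually orthogonal. Hence their sum converges strongly, to a projection that belongs to
`⋃ sᵢ`. -/
theorem exists_hasSum_of_disjoint {X : Type*} [MeasurableSpace X] {m : H → Measure X}
    [∀ x, IsFiniteMeasure (m x)] (hm : ∀ x, (m x).real Set.univ = ‖x‖ ^ 2) {s : ℕ → Set X}
    (hs : ∀ i, MeasurableSet (s i)) (hd : Pairwise (Disjoint on s)) {B : ℕ → H →L[ℂ] H}
    (hB : ∀ i, IsStarProjection (B i)) (hBm : ∀ i x, ‖B i x‖ ^ 2 = (m x).real (s i)) :
    ∃ P : H →L[ℂ] H, IsStarProjection P ∧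
      ∀ x, HasSum (fun i => B i x) (P x) ∧ ‖P x‖ ^ 2 = (m x).real (⋃ i, s i) := by
  have hidem : ∀ i x, B i (B i x) = B i x := fun i x =>
    congrArg (fun T => T x) (hB i).isIdempotentElem
  have hsymm : ∀ i x y, ⟪B i x, y⟫_ℂ = ⟪x, B i y⟫_ℂ := fun i =>
    ContinuousLinearMap.isSelfAdjoint_iff_isSymmetric.mp (hB i).isSelfAdjoint
  have hzero : ∀ i j, i ≠ j → ∀ x, B i (B j x) = 0 := by
    intro i j hij x
    have h1 := measureReal_union (μ := m (B j x)) (hd hij) (hs j)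
    have h2 : (m (B j x)).real (s i ∪ s j) ≤ (m (B j x)).real Set.univ :=
      measureReal_mono (Set.subset_univ _)
    rw [h1, hm, ← hBm, ← hBm, hidem] at h2
    rw [← norm_eq_zero, ← sq_eq_zero_iff]
    nlinarith [sq_nonneg ‖B i (B j x)‖]
  have hsq : ∀ x, HasSum (fun i => ‖B i x‖ ^ 2) ((m x).real (⋃ i, s i)) := by
    intro x
    have h1 := measure_iUnion (μ := m x) hd hs
    simp only [hBm, Measure.real]
    rw [h1, ENNReal.tsum_toReal_eq fun i => measure_ne_top _ _]
    exact ENNReal.hasSum_toReal (h1 ▸ measure_ne_top _ _)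
  let V : ∀ i, (LinearMap.range (B i : H →ₗ[ℂ] H)) →ₗᵢ[ℂ] H := fun i =>
    (LinearMap.range (B i : H →ₗ[ℂ] H)).subtypeₗᵢ
  have hV : OrthogonalFamily ℂ (fun i => LinearMap.range (B i : H →ₗ[ℂ] H)) V := by
    rintro i j hij ⟨_, v, rfl⟩ ⟨_, w, rfl⟩
    change ⟪B i v, B j w⟫_ℂ = 0
    rw [hsymm, hzero i j hij, inner_zero_right]
  have hsum : ∀ x, Summable (fun i => B i x) := fun x =>
    (hV.summable_iff_norm_sq_summable fun i => ⟨B i x, x, rfl⟩).mpr (hsq x).summable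
  have htend : Tendsto (fun (n : ℕ) x => (∑ i ∈ Finset.range n, B i) x) atTop
      (𝓝 fun x => ∑' i, B i x) := by
    refine tendsto_pi_nhds.mpr fun x => ?_
    simp only [sum_apply]
    exact (hsum x).hasSum.tendsto_sum_nat
  let P : H →L[ℂ] H := continuousLinearMapOfTendsto (fun n => ∑ i ∈ Finset.range n, B i) htend
  have hP : ∀ x, HasSum (fun i => B i x) (P x) := fun x => (hsum x).hasSum
  have hBP : ∀ i x, B i (P x) = B i x := by
    intro i x
    refine ((hP x).mapL (B i)).unique ?_
    have h1 := hasSum_single (f := fun j => B i (B j x)) i fun j hj => hzero i j hj.symm x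
    rwa [hidem] at h1
  have h1 : ∀ x, ⟪x, P x⟫_ℂ = (((m x).real (⋃ i, s i) : ℝ) : ℂ) := by
    intro x
    refine ((hP x).mapL (innerSL ℂ x)).unique ?_
    simp only [innerSL_apply_apply, inner_of_isStarProjection (hB _)]
    exact (Complex.hasSum_ofReal.mpr (hsq x))
  have h2 : ∀ x, ((‖P x‖ ^ 2 : ℝ) : ℂ) = (((m x).real (⋃ i, s i) : ℝ) : ℂ) := by
    intro x
    have h3 : ⟪P x, P x⟫_ℂ = ((‖P x‖ ^ 2 : ℝ) : ℂ) := by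
      rw [inner_self_eq_norm_sq_to_K]
      norm_cast
    rw [← h3]
    refine ((hP x).mapL (innerSL ℂ (P x))).unique ?_
    simp only [innerSL_apply_apply]
    simp only [← hsymm, hBP]
    simp only [hsymm, inner_of_isStarProjection (hB _)]
    exact (Complex.hasSum_ofReal.mpr (hsq x))
  exact ⟨P, isStarProjection_of_inner fun x => (h1 x).trans (h2 x).symm,
    fun x => ⟨hP x, Complex.ofReal_injective (h2 x)⟩⟩

end Projections

/-! ### The spectral measure of a representation of `C(X)` -/

section Representation

variable {X : Type*} [TopologicalSpace X]
  {H : Type*} [NormedAddCommGroup H] [InnerProductSpace ℂ H] [CompleteSpace H]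
  (π : C(X, ℝ) →⋆ₐ[ℝ] (H →L[ℂ] H))

theorem isSelfAdjoint_representation (f : C(X, ℝ)) : IsSelfAdjoint (π f) := by
  have h : IsSelfAdjoint f := by
    ext t
    rfl
  exact h.map π

theorem inner_representation_mul (f g : C(X, ℝ)) (x : H) :
    ⟪x, π (f * g) x⟫_ℂ = ⟪π f x, π g x⟫_ℂ := by
  rw [map_mul, mul_apply_eq_comp]
  exact (ContinuousLinearMap.isSelfAdjoint_iff_isSymmetric.mp (isSelfAdjoint_representation π f)
    x _).symm

variable [MeasurableSpace X] [BorelSpace X]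

/-- The Riesz-Markov-Kakutani theorem for the positive functional `f ↦ ⟨x, π(f) x⟩`. -/
theorem exists_measure_representation [CompactSpace X] [T2Space X] (x : H) : ∃ m : Measure X, IsFiniteMeasure m ∧
    ∀ f : C(X, ℝ), ⟪x, π f x⟫_ℂ = ((∫ t, f t ∂m : ℝ) : ℂ) := by
  let Λ : CompactlySupportedContinuousMap X ℝ →ₚ[ℝ] ℝ := PositiveLinearMap.mk₀
    { toFun := fun f => (⟪x, π f.toContinuousMap x⟫_ℂ).re
      map_add' := fun f g => by
        have : (f + g).toContinuousMap = f.toContinuousMap + g.toContinuousMap := rfl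
        rw [this, map_add, add_apply, inner_add_right, Complex.add_re]
      map_smul' := fun c f => by
        have : (c • f).toContinuousMap = c • f.toContinuousMap := rfl
        rw [this, map_smul, smul_apply, inner_smul_right_eq_smul, Complex.smul_re]
        rfl }
    (fun f hf => by
      change 0 ≤ (⟪x, π f.toContinuousMap x⟫_ℂ).re
      have : f.toContinuousMap = (⟨fun t => √(f t), by fun_prop⟩ : C(X, ℝ)) *
          ⟨fun t => √(f t), by fun_prop⟩ := by
        ext t
        exact (Real.mul_self_sqrt (hf t)).symm
      rw [this, inner_representation_mul, re_inner_self]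
      positivity)
  refine ⟨RealRMK.rieszMeasure Λ, inferInstance, fun f => ?_⟩
  have h1 := RealRMK.integral_rieszMeasure Λ (CompactlySupportedContinuousMap.continuousMapEquiv f)
  have h2 : ∫ t, f t ∂(RealRMK.rieszMeasure Λ) = (⟪x, π f x⟫_ℂ).re := h1
  rw [h2]
  apply Complex.ext
  · rw [Complex.ofReal_re]
  · rw [Complex.ofReal_im, ← Complex.conj_eq_iff_im, inner_conj_symm]
    exact ContinuousLinearMap.isSelfAdjoint_iff_isSymmetric.mp (isSelfAdjoint_representation π f)
      x x

/-- If continuous functions `fₙ` converge in `L²(m)`, where `m` is the measure of the vector `x`,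
then `π(fₙ) x` converges. -/
theorem exists_tendsto_representation {m : Measure X} [IsFiniteMeasure m] {x : H}
    (hm : ∀ f : C(X, ℝ), ⟪x, π f x⟫_ℂ = ((∫ t, f t ∂m : ℝ) : ℂ)) {f : ℕ → C(X, ℝ)}
    {φ F : X → ℝ} (hF : MemLp F 2 m) (hφ : AEStronglyMeasurable φ m)
    (hle : ∀ n, ∀ᵐ t ∂m, |f n t| ≤ F t)
    (hlim : ∀ᵐ t ∂m, Tendsto (fun n => f n t) atTop (𝓝 (φ t))) :
    ∃ v, Tendsto (fun n => π (f n) x) atTop (𝓝 v) := by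
  have hfm : ∀ n, AEStronglyMeasurable (f n) m := fun n => (f n).continuous.aestronglyMeasurable
  have hφF : ∀ᵐ t ∂m, |φ t| ≤ F t := by
    filter_upwards [hlim, ae_all_iff.mpr hle] with t h1 h2
    exact le_of_tendsto h1.abs (Eventually.of_forall h2)
  have hφ2 : MemLp φ 2 m := hF.mono' hφ hφF
  have hf2 : ∀ n, MemLp (f n) 2 m := fun n => hF.mono' (hfm n) (hle n)
  have ha : Tendsto (fun n => ∫ t, (f n t - φ t) ^ 2 ∂m) atTop (𝓝 0) := by
    have h0 : (0 : ℝ) = ∫ t, (0 : ℝ) ∂m := by simp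
    rw [h0]
    refine tendsto_integral_of_dominated_convergence (fun t => 4 * F t ^ 2)
      (fun n => (((hf2 n).sub hφ2).aestronglyMeasurable.pow 2)) (hF.integrable_sq.const_mul 4)
      (fun n => ?_) ?_
    · filter_upwards [hle n, hφF] with t h1 h2
      rw [Real.norm_of_nonneg (sq_nonneg _)]
      have h3 := abs_le.mp h1
      have h4 := abs_le.mp h2
      nlinarith
    · filter_upwards [hlim] with t h1
      have h2 := (h1.sub_const (φ t)).pow 2
      simpa using h2
  have hdist : ∀ n k, ‖π (f n) x - π (f k) x‖ ^ 2 ≤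
      2 * ∫ t, (f n t - φ t) ^ 2 ∂m + 2 * ∫ t, (f k t - φ t) ^ 2 ∂m := by
    intro n k
    have h1 := hm ((f n - f k) * (f n - f k))
    rw [inner_representation_mul, map_sub, sub_apply] at h1
    have h2 := congrArg Complex.re h1
    rw [re_inner_self, Complex.ofReal_re] at h2
    have i1 := ((hf2 n).sub hφ2).integrable_sq
    have i2 := ((hf2 k).sub hφ2).integrable_sq
    simp only [Pi.sub_apply] at i1 i2
    rw [h2, ← integral_const_mul, ← integral_const_mul,
      ← integral_add (i1.const_mul 2) (i2.const_mul 2)]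
    refine integral_mono_of_nonneg (Eventually.of_forall fun t => ?_)
      ((i1.const_mul 2).add (i2.const_mul 2)) (Eventually.of_forall fun t => ?_)
    · exact mul_self_nonneg _
    · simp only [ContinuousMap.mul_apply, ContinuousMap.sub_apply]
      nlinarith [sq_nonneg (f n t - φ t + (f k t - φ t))]
  refine cauchySeq_tendsto_of_complete (Metric.cauchySeq_iff.mpr fun ε hε => ?_)
  obtain ⟨N, hN⟩ := eventually_atTop.mp
    (ha.eventually (gt_mem_nhds (show (0 : ℝ) < ε ^ 2 / 4 by positivity)))
  refine ⟨N, fun n hn k hk => ?_⟩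
  rw [dist_eq_norm]
  refine lt_of_pow_lt_pow_left₀ 2 hε.le ?_
  linarith [hdist n k, hN n hn, hN k hk]

theorem exists_projection_of_isClosed [HasOuterApproxClosed X] {m : H → Measure X}
    [∀ x, IsFiniteMeasure (m x)]
    (hm : ∀ x (f : C(X, ℝ)), ⟪x, π f x⟫_ℂ = ((∫ t, f t ∂(m x) : ℝ) : ℂ)) {s : Set X}
    (hs : IsClosed s) :
    ∃ P : H →L[ℂ] H, IsStarProjection P ∧ ∀ x, ‖P x‖ ^ 2 = (m x).real s := by
  let f : ℕ → C(X, ℝ) := fun n => ⟨fun t => (hs.apprSeq n t : ℝ), by fun_prop⟩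
  let φ : X → ℝ := s.indicator fun _ => 1
  have hle : ∀ n t, |f n t| ≤ 1 := fun n t => by
    rw [abs_of_nonneg (show 0 ≤ f n t from NNReal.coe_nonneg _)]
    exact_mod_cast HasOuterApproxClosed.apprSeq_apply_le_one hs n t
  have hlim : ∀ t, Tendsto (fun n => f n t) atTop (𝓝 (φ t)) := fun t => by
    have h1 := tendsto_pi_nhds.mp (HasOuterApproxClosed.tendsto_apprSeq hs) t
    have h2 := (NNReal.continuous_coe.tendsto _).comp h1
    have h3 : ((s.indicator (fun _ => (1 : ℝ≥0)) t : ℝ≥0) : ℝ) = φ t := by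
      by_cases ht : t ∈ s <;> simp [φ, ht]
    rwa [h3] at h2
  have hφ : Measurable φ := measurable_const.indicator hs.measurableSet
  have hex : ∀ x, ∃ v, Tendsto (fun n => π (f n) x) atTop (𝓝 v) := fun x =>
    exists_tendsto_representation π (hm x) (memLp_const 1) hφ.aestronglyMeasurable
      (fun n => Eventually.of_forall (hle n)) (Eventually.of_forall hlim)
  choose p hp using hex
  let P : H →L[ℂ] H := continuousLinearMapOfTendsto (fun n => π (f n)) (tendsto_pi_nhds.mpr hp)
  have hP : ∀ x, Tendsto (fun n => π (f n) x) atTop (𝓝 (P x)) := hp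
  have hint : ∀ x (k : ℕ), k ≠ 0 →
      Tendsto (fun n => ∫ t, f n t ^ k ∂(m x)) atTop (𝓝 ((m x).real s)) := by
    intro x k hk
    have h1 : (m x).real s = ∫ t, φ t ^ k ∂(m x) := by
      have h2 : ∀ t, φ t ^ k = φ t := fun t => by
        by_cases ht : t ∈ s <;> simp [φ, ht, hk]
      simp only [h2]
      exact (integral_indicator_one hs.measurableSet).symm
    rw [h1]
    refine tendsto_integral_of_dominated_convergence (fun _ => 1)
      (fun n => ((f n).continuous.pow k).aestronglyMeasurable) (integrable_const 1)
      (fun n => Eventually.of_forall fun t => ?_) (Eventually.of_forall fun t => (hlim t).pow k)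
    rw [norm_pow, Real.norm_eq_abs]
    exact pow_le_one₀ (abs_nonneg _) (hle n t)
  have h1 : ∀ x, ⟪x, P x⟫_ℂ = (((m x).real s : ℝ) : ℂ) := by
    intro x
    refine tendsto_nhds_unique (tendsto_const_nhds.inner (hP x)) ?_
    simp only [hm]
    have := hint x 1 one_ne_zero
    simp only [pow_one] at this
    exact (Complex.continuous_ofReal.tendsto _).comp this
  have h2 : ∀ x, ‖P x‖ ^ 2 = (m x).real s := by
    intro x
    refine tendsto_nhds_unique ((hP x).norm.pow 2) ?_
    have h3 : ∀ n, ‖π (f n) x‖ ^ 2 = ∫ t, f n t ^ 2 ∂(m x) := fun n => by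
      have h4 := hm x (f n * f n)
      rw [inner_representation_mul] at h4
      have h5 := congrArg Complex.re h4
      rw [re_inner_self, Complex.ofReal_re] at h5
      rw [h5]
      simp only [ContinuousMap.mul_apply, pow_two]
    simp only [h3]
    exact hint x 2 two_ne_zero
  exact ⟨P, isStarProjection_of_inner fun x => by rw [h1, h2], h2⟩

/-- The spectral theorem for a representation `π` of `C(X)`: it is given by a spectral measure on
`X`. The Borel sets `s` for which `x ↦ μ_x(s)` is the quadratic form of a projection form a Dynkin
system that contains the closed sets. -/
theorem exists_spectralMeasure_representation [CompactSpace X] [T2Space X] [HasOuterApproxClosed X] :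
    ∃ E : SpectralMeasure X H, ∀ x (f : C(X, ℝ)),
      ⟪x, π f x⟫_ℂ = ((∫ t, f t ∂(E.scalarMeasure x) : ℝ) : ℂ) := by
  choose m hfin hm using exists_measure_representation (X := X) π
  have huniv : ∀ x, (m x).real Set.univ = ‖x‖ ^ 2 := by
    intro x
    have h1 := congrArg Complex.re (hm x 1)
    rw [map_one, one_apply_eq_self, re_inner_self, Complex.ofReal_re] at h1
    simpa using h1.symm
  have hex : ∀ s, MeasurableSet s →
      ∃ P : H →L[ℂ] H, IsStarProjection P ∧ ∀ x, ‖P x‖ ^ 2 = (m x).real s := by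
    intro s hs
    refine MeasurableSpace.induction_on_inter
      (C := fun s _ => ∃ P : H →L[ℂ] H, IsStarProjection P ∧ ∀ x, ‖P x‖ ^ 2 = (m x).real s)
      ((BorelSpace.measurable_eq (α := X)).trans borel_eq_generateFrom_isClosed)
      isPiSystem_isClosed ?_ ?_ ?_ ?_ s hs
    · exact ⟨0, IsStarProjection.zero _, by simp⟩
    · exact fun t ht => exists_projection_of_isClosed π hm ht
    · rintro t ht ⟨P, hP, hPm⟩
      refine ⟨1 - P, hP.one_sub, fun x => ?_⟩
      rw [measureReal_compl ht, huniv, ← hPm, sub_apply, one_apply_eq_self,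
        norm_sub_sq (𝕜 := ℂ), inner_of_isStarProjection hP]
      simp only [RCLike.re_eq_complex_re, Complex.ofReal_re]
      ring
    · intro t hd ht h
      choose B hB hBm using h
      obtain ⟨P, hP, hPm⟩ := exists_hasSum_of_disjoint huniv ht hd hB hBm
      exact ⟨P, hP, fun x => (hPm x).2⟩
  choose P hP hPm using hex
  classical
  let E : SpectralMeasure X H :=
    { proj := fun s => if hs : MeasurableSet s then P s hs else 0
      proj_of_not_measurableSet := fun s hs => dif_neg hs
      isStarProjection_proj := fun s hs => by
        rw [dif_pos hs]
        exact hP s hs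
      proj_univ := by
        rw [dif_pos MeasurableSet.univ]
        refine eq_of_norm_sq_eq (hP _ _) (ContinuousLinearMap.one_def (R₁ := ℂ) (M₁ := H) ▸ IsStarProjection.one _) fun x => ?_
        rw [hPm, huniv]
        rfl
      hasSum_proj := fun s hs hd x => by
        rw [dif_pos (MeasurableSet.iUnion hs)]
        simp only [dif_pos (hs _)]
        obtain ⟨Q, hQ, hQm⟩ := exists_hasSum_of_disjoint huniv hs hd
          (fun i => hP (s i) (hs i)) (fun i => hPm (s i) (hs i))
        have : P _ (MeasurableSet.iUnion hs) = Q :=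
          eq_of_norm_sq_eq (hP _ _) hQ fun x => by rw [hPm, (hQm x).2]
        rw [this]
        exact (hQm x).1 }
  refine ⟨E, fun x f => ?_⟩
  have h1 : E.scalarMeasure x = m x := by
    ext s hs
    have h2 : E.proj s = P s hs := dif_pos hs
    rw [E.scalarMeasure_apply x hs, h2, hPm, ofReal_measureReal]
  rw [h1, hm]

variable {π} {E : SpectralMeasure X H}
  (hE : ∀ x (f : C(X, ℝ)), ⟪x, π f x⟫_ℂ = ((∫ t, f t ∂(E.scalarMeasure x) : ℝ) : ℂ))
include hE

omit [BorelSpace X] in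
theorem norm_sq_representation (f : C(X, ℝ)) (x : H) :
    ‖π f x‖ ^ 2 = ∫ t, f t ^ 2 ∂(E.scalarMeasure x) := by
  have h1 := congrArg Complex.re (hE x (f * f))
  rw [inner_representation_mul, re_inner_self, Complex.ofReal_re] at h1
  rw [h1]
  simp only [ContinuousMap.mul_apply, pow_two]

/-- `μ_{π(g) w} = g² μ_w`. -/
theorem scalarMeasure_representation [HasOuterApproxClosed X] {g : C(X, ℝ)}
    (h0 : ∀ t, 0 ≤ g t) (h1 : ∀ t, g t ≤ 1) (w : H) : E.scalarMeasure (π g w) =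
      (E.scalarMeasure w).withDensity fun t => ENNReal.ofReal (g t) ^ 2 := by
  have hfin : IsFiniteMeasure
      ((E.scalarMeasure w).withDensity fun t => ENNReal.ofReal (g t) ^ 2) := by
    refine isFiniteMeasure_withDensity (ne_of_lt ?_)
    refine (lintegral_mono (g := fun _ => 1) fun t => ?_).trans_lt ?_
    · exact pow_le_one₀ zero_le (ENNReal.ofReal_le_one.mpr (h1 t))
    · rw [lintegral_one]
      exact measure_lt_top _ _
  refine ext_of_forall_integral_eq_of_IsFiniteMeasure fun f => ?_
  rw [integral_withDensity_sq g.continuous.measurable h0]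
  apply Complex.ofReal_injective
  have e1 := hE (π g w) f.toContinuousMap
  have e2 := hE w (g * (f.toContinuousMap * g))
  rw [inner_representation_mul, map_mul, mul_apply_eq_comp, e1] at e2
  refine e2.trans ?_
  congr 2
  ext t
  change g t * (f t * g t) = _
  ring

/-- If `π(g)` is injective, then the spectral measure has no mass on the zeros of `g`. -/
theorem ae_pos_of_injective {g : C(X, ℝ)} (h0 : ∀ t, 0 ≤ g t)
    (hinj : Function.Injective (π g)) (x : H) : ∀ᵐ t ∂(E.scalarMeasure x), 0 < g t := by
  let s : Set X := {t | g t ≤ 0}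
  have hs : MeasurableSet s := measurableSet_le g.continuous.measurable measurable_const
  have e1 := norm_sq_representation hE g (E.proj s x)
  rw [E.scalarMeasure_proj hs, setIntegral_congr_fun (g := fun _ => (0 : ℝ)) hs, integral_zero,
    sq_eq_zero_iff, norm_eq_zero] at e1
  · have e2 : E.proj s x = 0 := hinj (e1.trans (map_zero _).symm)
    rw [ae_iff]
    simp only [not_lt]
    rw [E.scalarMeasure_apply x hs, e2]
    simp
  · intro t ht
    have : g t = 0 := le_antisymm ht (h0 t)
    simp [this]

/-- A vector `x` with `g⁻¹ ∈ L²(μ_x)` lies in the range of an injective `π(g)`: regularize `g⁻¹` to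
`(max g (n + 1)⁻¹)⁻¹` and pass to the limit. -/
theorem exists_apply_eq_of_memLp_inv {g : C(X, ℝ)} (h0 : ∀ t, 0 ≤ g t)
    (hinj : Function.Injective (π g)) {x : H} (hx : MemLp (fun t => (g t)⁻¹) 2 (E.scalarMeasure x)) :
    ∃ v, π g v = x := by
  let h : ℕ → C(X, ℝ) := fun n => ⟨fun t => (max (g t) ((n : ℝ) + 1)⁻¹)⁻¹,
    (g.continuous.max continuous_const).inv₀ fun t =>
      (lt_max_of_lt_right (by positivity)).ne'⟩
  have hh : ∀ n t, h n t = (max (g t) ((n : ℝ) + 1)⁻¹)⁻¹ := fun n t => rfl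
  have hnull := ae_pos_of_injective hE h0 hinj x
  have hev : ∀ t, 0 < g t → ∀ᶠ n in atTop, h n t = (g t)⁻¹ := by
    intro t ht
    filter_upwards [tendsto_one_div_add_atTop_nhds_zero_nat.eventually_lt_const ht] with n hn
    rw [hh, max_eq_left]
    rw [← one_div]
    exact hn.le
  have hle : ∀ n t, 0 < g t → |h n t| ≤ (g t)⁻¹ := by
    intro n t ht
    rw [hh, abs_of_nonneg (inv_nonneg.mpr (ht.le.trans (le_max_left _ _)))]
    exact inv_anti₀ ht (le_max_left _ _)
  obtain ⟨v, hv⟩ := exists_tendsto_representation π (hE x) (f := h) (φ := fun t => (g t)⁻¹) hx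
    g.continuous.measurable.inv.aestronglyMeasurable (fun n => hnull.mono fun t ht => hle n t ht)
    (hnull.mono fun t ht => tendsto_const_nhds.congr' ((hev t ht).mono fun n hn => hn.symm))
  refine ⟨v, ?_⟩
  have e1 : Tendsto (fun n => π g (π (h n) x)) atTop (𝓝 (π g v)) :=
    ((π g).continuous.tendsto v).comp hv
  refine tendsto_nhds_unique e1 (tendsto_iff_norm_sub_tendsto_zero.mpr ?_)
  have e2 : ∀ n, ‖π g (π (h n) x) - x‖ ^ 2 =
      ∫ t, (g t * h n t - 1) ^ 2 ∂(E.scalarMeasure x) := by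
    intro n
    have e3 := norm_sq_representation hE (g * h n - 1) x
    rw [map_sub, map_mul, map_one, sub_apply, mul_apply_eq_comp, one_apply_eq_self] at e3
    exact e3
  have e4 : Tendsto (fun n => ‖π g (π (h n) x) - x‖ ^ 2) atTop (𝓝 0) := by
    simp only [e2]
    have e5 : (0 : ℝ) = ∫ _, (0 : ℝ) ∂(E.scalarMeasure x) := by simp
    rw [e5]
    refine tendsto_integral_of_dominated_convergence (fun _ => 1)
      (fun n => (((g * h n - 1) ^ 2 : C(X, ℝ)).continuous).aestronglyMeasurable)
      (integrable_const 1) (fun n => ?_) ?_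
    · filter_upwards [hnull] with t ht
      have e6 : 0 ≤ g t * h n t := by
        rw [hh]
        exact mul_nonneg ht.le (inv_nonneg.mpr (ht.le.trans (le_max_left _ _)))
      have e7 : g t * h n t ≤ 1 := by
        calc g t * h n t ≤ g t * (g t)⁻¹ :=
              mul_le_mul_of_nonneg_left ((le_abs_self _).trans (hle n t ht)) ht.le
          _ = 1 := mul_inv_cancel₀ ht.ne'
      rw [Real.norm_of_nonneg (sq_nonneg _)]
      nlinarith
    · filter_upwards [hnull] with t ht
      refine tendsto_const_nhds.congr' ((hev t ht).mono fun n hn => ?_)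
      beta_reduce
      rw [hn, mul_inv_cancel₀ ht.ne', sub_self, zero_pow two_ne_zero]
  have e8 := e4.sqrt
  simpa only [Real.sqrt_sq (norm_nonneg _), Real.sqrt_zero] using e8

/-- If `π(g) = (I + M)⁻¹`, then `M = ∫ (g⁻¹ - 1) dE`. -/
theorem isIntegral_of_representation [HasOuterApproxClosed X] {g : C(X, ℝ)} {M : H →ₗ.[ℂ] H}
    (h0 : ∀ t, 0 ≤ g t) (h1 : ∀ t, g t ≤ 1) (hM : IsResolvent (π g) M) :
    E.IsIntegral (fun t => (((g t)⁻¹ - 1).toNNReal : ℝ)) M := by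
  set f : X → ℝ := fun t => (((g t)⁻¹ - 1).toNNReal : ℝ) with hf_def
  have hgm : Measurable g := g.continuous.measurable
  have hf : Measurable f := (hgm.inv.sub_const 1).real_toNNReal.coe_nnreal_real
  have hf0 : ∀ t, 0 ≤ f t := fun t => NNReal.coe_nonneg _
  have hfpos : ∀ t, 0 < g t → f t = (g t)⁻¹ - 1 := fun t ht =>
    Real.coe_toNNReal _ (sub_nonneg.mpr ((one_le_inv₀ ht).mpr (h1 t)))
  refine SpectralMeasure.IsIntegral.of_graph (fun x => ⟨?_, fun hx => ?_⟩) fun x y hxy => ?_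
  · rintro ⟨y, hxy⟩
    have hw := (hM.mem_graph x y).mp hxy
    rw [← hw, scalarMeasure_representation hE h0 h1, memLp_withDensity_sq_iff hgm h0 hf]
    refine MemLp.of_bound (hgm.mul hf).aestronglyMeasurable 1 (Eventually.of_forall fun t => ?_)
    rw [Real.norm_of_nonneg (mul_nonneg (h0 t) (hf0 t))]
    rcases (h0 t).eq_or_lt with ht | ht
    · rw [← ht, zero_mul]
      exact zero_le_one
    · rw [hfpos t ht, mul_sub, mul_inv_cancel₀ ht.ne']
      linarith
  · have hF : MemLp (fun t => (g t)⁻¹) 2 (E.scalarMeasure x) := by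
      refine ((memLp_const (1 : ℝ)).add hx).ae_eq ?_
      filter_upwards [ae_pos_of_injective hE h0 hM.injective x] with t ht
      rw [Pi.add_apply, hfpos t ht, add_sub_cancel]
    obtain ⟨v, rfl⟩ := exists_apply_eq_of_memLp_inv hE h0 hM.injective hF
    exact ⟨_, hM.apply_mem_graph v⟩
  · have hw := (hM.mem_graph x y).mp hxy
    obtain ⟨w, rfl⟩ : ∃ w, y = w - x := ⟨x + y, (add_sub_cancel_left _ _).symm⟩
    rw [add_sub_cancel] at hw
    rw [← hw, scalarMeasure_representation hE h0 h1, integral_withDensity_sq hgm h0]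
    have e1 := hE w (g * (1 - g))
    rw [inner_representation_mul, map_sub, map_one, sub_apply, one_apply_eq_self] at e1
    rw [e1]
    congr 2
    ext t
    rw [ContinuousMap.mul_apply, ContinuousMap.sub_apply, ContinuousMap.one_apply]
    rcases (h0 t).eq_or_lt with ht | ht
    · rw [← ht]
      simp
    · rw [hfpos t ht]
      field_simp

end Representation

/-! ### The spectral theorem for positive selfadjoint operators -/

namespace IsResolvent

variable {H : Type*} [NormedAddCommGroup H] [InnerProductSpace ℂ H] [CompleteSpace H]
  {K : H →L[ℂ] H} {M : H →ₗ.[ℂ] H}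

theorem spectrum_subset (hK : IsResolvent K M) {r : ℝ} (hr : r ∈ spectrum ℝ K) :
    0 ≤ r ∧ r ≤ 1 := by
  have hsa : IsSelfAdjoint K := hK.isSelfAdjoint
  have h1 : cfc (fun r : ℝ => r - r * r) K = K - K * K := by
    rw [cfc_sub (fun r : ℝ => r) (fun r => r * r) K, cfc_mul (fun r : ℝ => r) (fun r => r) K,
      cfc_id' ℝ K]
  have h2 : 0 ≤ r - r * r := by
    refine (cfc_nonneg_iff (fun r : ℝ => r - r * r) K).mp ?_ r hr
    rw [h1, ContinuousLinearMap.nonneg_iff_isPositive, ContinuousLinearMap.isPositive_def]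
    refine ⟨ContinuousLinearMap.isSelfAdjoint_iff_isSymmetric.mp
      (hsa.sub (by simpa only [pow_two] using hsa.pow 2)), fun x => ?_⟩
    rw [ContinuousLinearMap.reApplyInnerSelf_apply, sub_apply, mul_apply_eq_comp, inner_sub_left,
      map_sub, hK.inner_comm, hK.inner_comm (K x),
      inner_self_eq_norm_sq]
    exact sub_nonneg.mpr (hK.norm_sq_le x)
  constructor <;> nlinarith [sq_nonneg r, sq_nonneg (r - 1)]

/-- The spectral theorem for a positive selfadjoint operator `M`, obtained from the spectral measure
of its resolvent `K = (I + M)⁻¹` by the substitution `t = r⁻¹ - 1`. -/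
theorem exists_isIntegral (hK : IsResolvent K M) :
    ∃ E : SpectralMeasure ℝ≥0 H, E.IsIntegral (fun t => (t : ℝ)) M := by
  have : CompactSpace (spectrum ℝ K) := ContinuousFunctionalCalculus.compactSpace_spectrum K
  obtain ⟨E, hE⟩ := exists_spectralMeasure_representation (cfcHom (R := ℝ) hK.isSelfAdjoint)
  have hid := cfcHom_id (R := ℝ) hK.isSelfAdjoint
  have hg : Measurable fun r : spectrum ℝ K => ((r : ℝ)⁻¹ - 1).toNNReal :=
    (measurable_subtype_coe.inv.sub_const 1).real_toNNReal
  have h := isIntegral_of_representation (M := M) hE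
    (g := ContinuousMap.restrict (spectrum ℝ K) (ContinuousMap.id ℝ))
    (fun r => (hK.spectrum_subset r.2).1) (fun r => (hK.spectrum_subset r.2).2)
    (by rw [hid]; exact hK)
  exact ⟨E.map _ hg, SpectralMeasure.IsIntegral.of_comp (f := fun t : ℝ≥0 => (t : ℝ)) E hg
    measurable_coe_nnreal_real h⟩

end IsResolvent

end Existence

variable {H : Type*} [NormedAddCommGroup H] [InnerProductSpace ℂ H] [CompleteSpace H]

/-! ### The square root of a positive selfadjoint operator -/

/-- The bounded operators `Q = R^{1/2}`, `N = (I - R)^{1/2}` and `K = k(R)`, where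
`k(r) = √r / (√r + √(1 - r))`, for the resolvent `R` of a positive selfadjoint operator. -/
theorem IsResolvent.exists_bounded_sqrt {R : H →L[ℂ] H} {T : H →ₗ.[ℂ] H} (hR : IsResolvent R T) :
    ∃ Q N K : H →L[ℂ] H, Q * Q = R ∧ N * N = 1 - R ∧ Commute Q N ∧ Commute K Q ∧
      (Q + N) * K = Q ∧ K * (Q + N) = Q ∧ IsSelfAdjoint K ∧ 0 ≤ K - K * K := by
  have hsa : IsSelfAdjoint R := hR.isSelfAdjoint
  have hpos : ∀ r : ℝ, 0 < √r + √(1 - r) := fun r => by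
    rcases le_or_gt r 0 with h | h
    · have := Real.sqrt_pos.mpr (show 0 < 1 - r by linarith)
      positivity
    · have := Real.sqrt_pos.mpr h
      positivity
  obtain ⟨k, hk⟩ : ∃ k : ℝ → ℝ, k = fun r => √r / (√r + √(1 - r)) := ⟨_, rfl⟩
  have hkc : ContinuousOn k (spectrum ℝ R) := by
    rw [hk]
    exact (Continuous.div (by fun_prop) (by fun_prop) fun r => (hpos r).ne').continuousOn
  have hSK : (cfc (fun r : ℝ => √r) R + cfc (fun r : ℝ => √(1 - r)) R) * cfc k R =
      cfc (fun r : ℝ => √r) R := by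
    rw [← cfc_add (a := R) (fun r : ℝ => √r) (fun r => √(1 - r)),
      ← cfc_mul (fun r : ℝ => √r + √(1 - r)) k R]
    refine cfc_congr fun r _ => ?_
    rw [hk]
    exact mul_div_cancel₀ _ (hpos r).ne'
  have hKS : Commute (cfc k R) (cfc (fun r : ℝ => √r) R + cfc (fun r : ℝ => √(1 - r)) R) :=
    (cfc_commute_cfc _ _ R).add_right (cfc_commute_cfc _ _ R)
  refine ⟨cfc (fun r : ℝ => √r) R, cfc (fun r : ℝ => √(1 - r)) R, cfc k R, ?_, ?_,
    cfc_commute_cfc _ _ R, cfc_commute_cfc _ _ R, hSK, hKS.eq.trans hSK, cfc_predicate _ R, ?_⟩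
  · rw [← cfc_mul (fun r : ℝ => √r) (fun r => √r) R]
    conv_rhs => rw [← cfc_id' ℝ R]
    exact cfc_congr fun r hr => Real.mul_self_sqrt (hR.spectrum_subset hr).1
  · rw [← cfc_mul (fun r : ℝ => √(1 - r)) (fun r => √(1 - r)) R]
    conv_rhs => rw [← cfc_id' ℝ R, ← cfc_const_one ℝ R,
      ← cfc_sub (fun _ : ℝ => 1) (fun r => r) R]
    exact cfc_congr fun r hr => Real.mul_self_sqrt (sub_nonneg.mpr (hR.spectrum_subset hr).2)
  · rw [← cfc_mul k k R, ← cfc_sub k (fun r => k r * k r) R]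
    refine cfc_nonneg fun r _ => ?_
    have h1 : 0 ≤ k r := by
      rw [hk]
      exact div_nonneg (Real.sqrt_nonneg _) (hpos r).le
    have h2 : k r ≤ 1 := by
      rw [hk]
      exact (div_le_one (hpos r)).mpr (le_add_of_nonneg_right (Real.sqrt_nonneg _))
    nlinarith

/-- A positive selfadjoint operator `T` with resolvent `R = (I + T)⁻¹` has a positive selfadjoint
square root `M`. In terms of `Q = R^{1/2}` and `N = (I - R)^{1/2}` it is `M = N Q⁻¹`, so its graph
is `{(x, y) : N x = Q y}`. -/
theorem IsResolvent.exists_sqrt {R : H →L[ℂ] H} {T : H →ₗ.[ℂ] H} (hR : IsResolvent R T) :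
    ∃ (K : H →L[ℂ] H) (M : H →ₗ.[ℂ] H), IsResolvent K M ∧ mul M M = T := by
  obtain ⟨Q, N, K, hQQ, hNN, hQN, hKQ, hSK, hKS, hKsa, hKK⟩ := hR.exists_bounded_sqrt
  have happ : ∀ {A B : H →L[ℂ] H}, A = B → ∀ v, A v = B v := fun h v => by rw [h]
  have hR1 : ∀ v, Q (Q v) = R v := happ hQQ
  have hN1 : ∀ v, N (N v) = v - R v := happ hNN
  have hc : ∀ v, Q (N v) = N (Q v) := happ hQN.eq
  have hKQ1 : ∀ v, K (Q v) = Q (K v) := happ hKQ.eq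
  have hSK1 : ∀ v, Q (K v) + N (K v) = Q v := happ hSK
  have hKS1 : ∀ v, K (Q v + N v) = Q v := happ hKS
  have hQinj : ∀ y, Q y = 0 → y = 0 := fun y hy => by
    apply hR.injective
    rw [map_zero, ← hR1, hy, map_zero]
  obtain ⟨G, hG⟩ : ∃ G : Submodule ℂ (H × H), ∀ x y, (x, y) ∈ G ↔ N x = Q y :=
    ⟨{ carrier := {p | N p.1 = Q p.2}
       zero_mem' := by
        change N 0 = Q 0
        rw [map_zero, map_zero]
       add_mem' := fun {p q} (hp : N p.1 = Q p.2) (hq : N q.1 = Q q.2) => by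
        change N (p.1 + q.1) = Q (p.2 + q.2)
        rw [map_add, map_add, hp, hq]
       smul_mem' := fun c p (hp : N p.1 = Q p.2) => by
        change N (c • p.1) = Q (c • p.2)
        rw [map_smul, map_smul, hp] }, fun x y => Iff.rfl⟩
  obtain ⟨M, hM⟩ : ∃ M : H →ₗ.[ℂ] H, ∀ x y, (x, y) ∈ M.graph ↔ N x = Q y := by
    refine ⟨G.toLinearPMap, fun x y => ?_⟩
    rw [Submodule.toLinearPMap_graph_eq G, hG]
    rintro ⟨x, y⟩ hxy (rfl : x = 0)
    rw [hG, map_zero] at hxy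
    exact hQinj y hxy.symm
  refine ⟨K, M, ⟨hKsa, fun x => ?_, fun x y => ?_⟩, ext_graph fun x z => ?_⟩
  · have h1 := ((ContinuousLinearMap.nonneg_iff_isPositive _).mp hKK).inner_nonneg_right x
    have h2 := ContinuousLinearMap.isSelfAdjoint_iff_isSymmetric.mp hKsa x (K x)
    simp only [ContinuousLinearMap.coe_coe] at h2
    rw [sub_apply, mul_apply_eq_comp, inner_sub_right, ← h2] at h1
    have h3 := (Complex.nonneg_iff.mp h1).1
    rw [Complex.sub_re, re_inner_self] at h3
    linarith
  · rw [hM]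
    constructor
    · intro h
      have h1 := hKS1 x
      rw [h, ← map_add, hKQ1, ← sub_eq_zero, ← map_sub] at h1
      exact sub_eq_zero.mp (hQinj _ h1)
    · intro h
      have h1 := hSK1 (x + y)
      rw [h, map_add] at h1
      exact add_left_cancel h1
  · rw [mem_graph_mul, hR.mem_graph]
    constructor
    · rintro ⟨y, hxy, hyz⟩
      rw [hM] at hxy hyz
      have h1 : x - R x = R z := by
        rw [← hN1, hxy, ← hc, hyz, hR1]
      rw [map_add, ← h1, add_sub_cancel]
    · intro h
      refine ⟨N (Q (x + z)), (hM _ _).mpr ?_, (hM _ _).mpr ?_⟩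
      · rw [hc, hR1, h]
      · rw [hN1, ← hR1, hR1 (x + z), h, ← map_sub, add_sub_cancel_left]

/-! ### The equivalences -/

omit [CompleteSpace H] in
theorem mul_pow_one (A B : H →ₗ.[ℂ] H) : mul (pow A 1) (pow B 1) = mul A B :=
  ext_graph fun x z => by simp only [mem_graph_mul, mem_graph_pow_one]

omit [CompleteSpace H] in
theorem pow_two_eq_mul (A : H →ₗ.[ℂ] H) : pow A 2 = mul A A :=
  ext_graph fun x z => by simp only [mem_graph_pow_succ, mem_graph_mul, mem_graph_pow_zero,
    exists_eq_right]

/-- For the spectral measure `E` of `|C|`, condition `E(s) C ⊆ C E(s)` for all `s` implies that the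
resolvent of `C* C` intertwines `C`. -/
theorem IsQuasinormal.intertwines {C : H →ₗ.[ℂ] H} {R : H →L[ℂ] H} (h : IsQuasinormal C)
    (hR : IsResolvent R (mul C† C)) : Intertwines R C := by
  obtain ⟨hC, -, M, E, hM, hE, hEC⟩ := h
  have h2 := hE.pow measurable_coe_nnreal_real (fun t => t.2) 2
  rw [pow_two_eq_mul, hM.mul_self] at h2
  exact SpectralMeasure.intertwines_resolvent_of_proj hC hR
    (measurable_coe_nnreal_real.pow_const 2) (fun t => sq_nonneg _) h2
    fun s hs => intertwines_iff.mpr (hEC s hs)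

/-- If the resolvent of `C* C` intertwines `C`, then `C` is quasinormal: the spectral measure of
`|C|` and the spectral measure of `C* C` have the same values, up to the substitution `t ↦ t²`. -/
theorem Intertwines.isQuasinormal {C : H →ₗ.[ℂ] H} {R : H →L[ℂ] H} (hC : C.IsClosed)
    (hd : Dense (C.domain : Set H)) (hR : IsResolvent R (mul C† C)) (h : Intertwines R C) :
    IsQuasinormal C := by
  obtain ⟨K, M, hK, hM⟩ := hR.exists_sqrt
  obtain ⟨E, hE⟩ := hK.exists_isIntegral
  refine ⟨hC, hd, M, E, ⟨hK.selfAdjoint, fun x => hK.nonneg (M.mem_graph x), hM⟩, hE,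
    fun s hs => intertwines_iff.mp ?_⟩
  have hsq : Measurable fun t : ℝ≥0 => t ^ 2 := measurable_id.pow_const 2
  have h2 := hE.pow measurable_coe_nnreal_real (fun t => t.2) 2
  rw [pow_two_eq_mul, hM] at h2
  have h3 : (E.map _ hsq).IsIntegral (fun t => (t : ℝ)) (mul C† C) := by
    refine SpectralMeasure.IsIntegral.of_comp E hsq measurable_coe_nnreal_real ?_
    simpa only [Function.comp_def, NNReal.coe_pow] using h2
  have hs' : MeasurableSet (NNReal.sqrt ⁻¹' s) := NNReal.continuous_sqrt.measurable hs
  have h4 := SpectralMeasure.intertwines_proj_of_resolvent hC hR h3 h hs'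
  rw [E.map_proj hsq hs', ← Set.preimage_comp] at h4
  have h5 : (NNReal.sqrt ∘ fun t : ℝ≥0 => t ^ 2) = id := by
    ext1 t
    exact NNReal.sqrt_sq t
  rwa [h5, Set.preimage_id] at h4

end

end UnboundedOp

theorem theorem3p6 {H : Type*} [NormedAddCommGroup H] [InnerProductSpace ℂ H] [CompleteSpace H]
    (C : H →ₗ.[ℂ] H) (hC : C.IsClosed) (hd : Dense (C.domain : Set H)) :
    -- the five conditions are equivalent
    List.TFAE [
      IsQuasinormal C,
      ∀ n : ℕ, mul (pow C† n) (pow C n) = pow (mul C† C) n,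
      ∃ E : SpectralMeasure ℝ≥0 H, ∀ n : ℕ,
        E.IsIntegral (fun t => (t : ℝ) ^ n) (mul (pow C† n) (pow C n)),
      ∃ E : SpectralMeasure ℝ≥0 H, ∀ n ∈ ({1, 2, 3} : Set ℕ),
        E.IsIntegral (fun t => (t : ℝ) ^ n) (mul (pow C† n) (pow C n)),
      ∀ n ∈ ({2, 3} : Set ℕ), mul (pow C† n) (pow C n) = pow (mul C† C) n] ∧
    -- uniqueness of the spectral measure in the third condition
    (∀ E F : SpectralMeasure ℝ≥0 H,
      (∀ n : ℕ, E.IsIntegral (fun t => (t : ℝ) ^ n) (mul (pow C† n) (pow C n))) →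
      (∀ n : ℕ, F.IsIntegral (fun t => (t : ℝ) ^ n) (mul (pow C† n) (pow C n))) → E = F) ∧
    -- uniqueness of the spectral measure in the fourth condition
    (∀ E F : SpectralMeasure ℝ≥0 H,
      (∀ n ∈ ({1, 2, 3} : Set ℕ),
        E.IsIntegral (fun t => (t : ℝ) ^ n) (mul (pow C† n) (pow C n))) →
      (∀ n ∈ ({1, 2, 3} : Set ℕ),
        F.IsIntegral (fun t => (t : ℝ) ^ n) (mul (pow C† n) (pow C n))) → E = F) := by
  obtain ⟨R, hR⟩ := exists_isResolvent_adjoint_mul_self hC hd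
  have hone : ∀ {E : SpectralMeasure ℝ≥0 H},
      E.IsIntegral (fun t => (t : ℝ) ^ 1) (mul (pow C† 1) (pow C 1)) →
        E.IsIntegral (fun t => (t : ℝ)) (mul C† C) := by
    intro E hE
    simpa only [pow_one, mul_pow_one] using hE
  refine ⟨?_, fun E F hE hF => SpectralMeasure.eq_of_isIntegral hR (hone (hE 1)) (hone (hF 1)),
    fun E F hE hF => SpectralMeasure.eq_of_isIntegral hR (hone (hE 1 (by simp)))
      (hone (hF 1 (by simp)))⟩
  tfae_have 1 → 2 := fun h => (h.intertwines hR).pow_adjoint_mul_pow hd hR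
  tfae_have 2 → 3 := fun h => by
    obtain ⟨E, hE⟩ := hR.exists_isIntegral
    refine ⟨E, fun n => ?_⟩
    rw [h n]
    exact hE.pow measurable_coe_nnreal_real (fun t => t.2) n
  tfae_have 3 → 4 := fun ⟨E, hE⟩ => ⟨E, fun n _ => hE n⟩
  tfae_have 4 → 5 := fun ⟨E, hE⟩ n hn => by
    have h1 := (hone (hE 1 (by simp))).pow measurable_coe_nnreal_real (fun t => t.2) n
    exact (hE n (Set.mem_insert_of_mem 1 hn)).unique (measurable_coe_nnreal_real.pow_const n) h1
  tfae_have 5 → 1 := fun h => (intertwines_of_pow_adjoint_mul_pow hC hd hR (h 2 (by simp))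
    (h 3 (by simp))).isQuasinormal hC hd hR
  tfae_finish
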